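/- Theorem 4.8. Conventions. Two projections $p,q$ in a C*-algebra $A$ are equivalent, $p\sim q$, if $v^*v=p$, $vv^*=q$ for some $v\in A$ (for projections in $M_m(A)$ and $M_n(A)$: for some rectangular $n\times m$ matrix $v$ over $A$). For a projection $p$ and a positive element $a$, write $p\preceq a$ if $p$ is equivalent to a projection in $\overline{aAa}$. For unital $A$, $V(A)$ is the abelian monoid of equivalence classes $[p]$ of projections in the matrix algebras $M_n(A)$, with $[p]+[q]=[p\oplus q]$, and $x\le y$ in $V(A)$ means $x+z=y$ for some $z\in V(A)$; $K_0(A)$ is the Grothendieck group of $V(A)$, and $K_0(A)_+$ is the image of $V(A)$ in $K_0(A)$. For $x,y\in K_0(A)$, $x\le y$ means $y-x\in K_0(A)_+$, and $x<y$ means $x\le y$ and $x\ne y$. An element $a\in A$ is full if the closed two-sided ideal it generates is $A$. $A$ is simple if $A\neq 0$ and its only closed two-sided ideals are $0$ and $A$. Let $\mathcal I$ be the class of finite direct sums of C*-algebras isomorphic to $M_k(\mathbb C)$ or $M_k(C([0,1]))$, $k\ge 1$. A unital C*-algebra $A$ is tracially approximately interval (TAI) if for every finite subset $F\subset A$ containing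 a nonzero element $b$, every $\varepsilon>0$, every integer $n>0$ and every full positive element $a\in A$, there are a nonzero projection $p\in A$ and a C*-subalgebra $I\subset A$ with $I\in\mathcal I$ and unit $1_I=p$ such that (1) $\|xp-px\|<\varepsilon$ for all $x\in F$; (2) for every $x\in F$ there is $y\in I$ with $\|pxp-y\|<\varepsilon$, and $\|pbp\|\ge\|b\|-\varepsilon$; (3) $n[1-p]\le[p]$ in $V(A)$, and $1-p\preceq a$. Theorem. Let $A$ be a unital simple TAI C*-algebra. Then $(K_0(A),K_0(A)_+)$ is an ordered group, that is, $K_0(A)=K_0(A)_+-K_0(A)_+$ and $K_0(A)_+\cap(-K_0(A)_+)=\{0\}$; it is weakly unperforated: if $x\in K_0(A)$ and $nx>0$ for some integer $n>0$, then $x>0$; and it has the Riesz interpolation property: if $a_1,a_2,b_1,b_2\in K_0(A)$ satisfy $a_i\le b_j$ for all $i,j\in\{1,2\}$, then there is $c\in K_0(A)$ with $a_i\le c\le b_j$ for all $i,j\in\{1,2\}$. -/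

import Mathlib

open scoped Matrix

section MurrayVonNeumann

variable {A : Type*} [Ring A] [StarRing A]

/-- Murray-von Neumann equivalence of matrices `p` and `q` over a star ring, of possibly different
sizes: there is a rectangular matrix `v` with `v* v = p` and `v v* = q`. -/
def Matrix.MvN {m n : Type*} [Fintype m] [Fintype n] (p : Matrix m m A) (q : Matrix n n A) : Prop :=
  ∃ v : Matrix n m A, vᴴ * v = p ∧ v * vᴴ = q

theorem Matrix.MvN.refl {m : Type*} [Fintype m] {p : Matrix m m A} (hp : IsStarProjection p) :
    Matrix.MvN p p := by
  have h1 : pᴴ = p := hp.isSelfAdjoint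
  have h2 : p * p = p := hp.isIdempotentElem
  exact ⟨p, by rw [h1, h2], by rw [h1, h2]⟩

theorem Matrix.MvN.symm {m n : Type*} [Fintype m] [Fintype n] {p : Matrix m m A}
    {q : Matrix n n A} (h : Matrix.MvN p q) : Matrix.MvN q p := by
  obtain ⟨v, h1, h2⟩ := h
  exact ⟨vᴴ, by rwa [Matrix.conjTranspose_conjTranspose],
    by rwa [Matrix.conjTranspose_conjTranspose]⟩

theorem Matrix.MvN.trans {l m n : Type*} [Fintype l] [Fintype m] [Fintype n] {p : Matrix l l A}
    {q : Matrix m m A} {r : Matrix n n A} (hp : IsStarProjection p) (hr : IsStarProjection r)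
    (h : Matrix.MvN p q) (h' : Matrix.MvN q r) : Matrix.MvN p r := by
  obtain ⟨v, h1, h2⟩ := h
  obtain ⟨w, h3, h4⟩ := h'
  have hp2 : p * p = p := hp.isIdempotentElem
  have hr2 : r * r = r := hr.isIdempotentElem
  refine ⟨w * v, ?_, ?_⟩
  · calc (w * v)ᴴ * (w * v) = vᴴ * (wᴴ * w) * v := by
          rw [Matrix.conjTranspose_mul]; simp only [Matrix.mul_assoc]
      _ = (vᴴ * v) * (vᴴ * v) := by rw [h3, ← h2]; simp only [Matrix.mul_assoc]
      _ = p := by rw [h1, hp2]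
  · calc (w * v) * (w * v)ᴴ = w * (v * vᴴ) * wᴴ := by
          rw [Matrix.conjTranspose_mul]; simp only [Matrix.mul_assoc]
      _ = (w * wᴴ) * (w * wᴴ) := by rw [h2, ← h3]; simp only [Matrix.mul_assoc]
      _ = r := by rw [h4, hr2]

theorem Matrix.MvN.submatrix {m n : Type*} [Fintype m] [Fintype n]
    {p : Matrix m m A} (hp : IsStarProjection p) (e : n ≃ m) :
    Matrix.MvN p (p.submatrix e e) := by
  have h1 : pᴴ = p := hp.isSelfAdjoint
  have h2 : p * p = p := hp.isIdempotentElem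
  refine ⟨p.submatrix e id, ?_, ?_⟩
  · rw [Matrix.conjTranspose_submatrix, h1, Matrix.submatrix_mul_equiv, h2, Matrix.submatrix_id_id]
  · rw [Matrix.conjTranspose_submatrix, h1, ← Equiv.coe_refl, Matrix.submatrix_mul_equiv, h2]

theorem Matrix.isStarProjection_submatrix {m n : Type*} [Fintype m] [Fintype n]
    {p : Matrix m m A} (hp : IsStarProjection p) (e : n ≃ m) :
    IsStarProjection (p.submatrix e e) := by
  have h1 : pᴴ = p := hp.isSelfAdjoint
  have h2 : p * p = p := hp.isIdempotentElem
  refine ⟨?_, ?_⟩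
  · change p.submatrix e e * p.submatrix e e = p.submatrix e e
    rw [Matrix.submatrix_mul_equiv, h2]
  · change (p.submatrix e e)ᴴ = p.submatrix e e
    rw [Matrix.conjTranspose_submatrix, h1]

theorem Matrix.isStarProjection_fromBlocks {m n : Type*} [Fintype m] [Fintype n]
    {p : Matrix m m A} {q : Matrix n n A} (hp : IsStarProjection p) (hq : IsStarProjection q) :
    IsStarProjection (Matrix.fromBlocks p 0 0 q) := by
  have h1 : pᴴ = p := hp.isSelfAdjoint
  have h2 : p * p = p := hp.isIdempotentElem
  have h3 : qᴴ = q := hq.isSelfAdjoint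
  have h4 : q * q = q := hq.isIdempotentElem
  refine ⟨?_, ?_⟩
  · change Matrix.fromBlocks p 0 0 q * Matrix.fromBlocks p 0 0 q = _
    simp [Matrix.fromBlocks_multiply, h2, h4]
  · change (Matrix.fromBlocks p 0 0 q)ᴴ = _
    simp [Matrix.fromBlocks_conjTranspose, h1, h3]

theorem Matrix.MvN.fromBlocks {m n m' n' : Type*} [Fintype m] [Fintype n] [Fintype m'] [Fintype n']
    {p : Matrix m m A} {q : Matrix n n A} {p' : Matrix m' m' A} {q' : Matrix n' n' A}
    (h : Matrix.MvN p p') (h' : Matrix.MvN q q') :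
    Matrix.MvN (Matrix.fromBlocks p 0 0 q) (Matrix.fromBlocks p' 0 0 q') := by
  obtain ⟨v, h1, h2⟩ := h
  obtain ⟨w, h3, h4⟩ := h'
  refine ⟨Matrix.fromBlocks v 0 0 w, ?_, ?_⟩ <;>
    simp [Matrix.fromBlocks_conjTranspose, Matrix.fromBlocks_multiply, h1, h2, h3, h4]

variable (A) in
/-- Projections in square matrices of arbitrary finite size over `A`. -/
structure MatProj where
  /-- the size of the matrix -/
  size : ℕ
  /-- the matrix -/
  mat : Matrix (Fin size) (Fin size) A
  isProj : IsStarProjection mat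

namespace MatProj

/-- Murray-von Neumann equivalence on the projections of all the matrix algebras over `A`. -/
instance setoid : Setoid (MatProj A) where
  r p q := Matrix.MvN p.mat q.mat
  iseqv :=
    { refl := fun p => Matrix.MvN.refl p.isProj
      symm := fun h => h.symm
      trans := fun {p _ r} h h' => Matrix.MvN.trans p.isProj r.isProj h h' }

/-- The direct sum `p ⊕ q = diag(p, q)`. -/
def sum (p q : MatProj A) : MatProj A :=
  ⟨p.size + q.size, (Matrix.fromBlocks p.mat 0 0 q.mat).submatrix finSumFinEquiv.symm finSumFinEquiv.symm,
    Matrix.isStarProjection_submatrix (Matrix.isStarProjection_fromBlocks p.isProj q.isProj) _⟩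

theorem sum_mvN (p q : MatProj A) :
    Matrix.MvN (Matrix.fromBlocks p.mat 0 0 q.mat) (p.sum q).mat :=
  Matrix.MvN.submatrix (Matrix.isStarProjection_fromBlocks p.isProj q.isProj) _

/-- The zero projection (of size `0`). -/
def zero : MatProj A := ⟨0, 0, IsStarProjection.zero _⟩

/-- A projection of `A`, seen as a projection of `M₁(A)`. -/
def single (p : A) (hp : IsStarProjection p) : MatProj A :=
  ⟨1, Matrix.of fun _ _ => p, by
    have h1 : star p = p := hp.isSelfAdjoint
    have h2 : p * p = p := hp.isIdempotentElem
    refine ⟨?_, ?_⟩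
    · ext i j
      simp [Matrix.mul_apply, h2]
    · ext i j
      simp [Matrix.star_apply, h1]⟩

theorem sum_congr {p p' q q' : MatProj A} (h : p ≈ p') (h' : q ≈ q') :
    p.sum q ≈ p'.sum q' := by
  have h1 : Matrix.MvN (Matrix.fromBlocks p.mat 0 0 q.mat) (p'.sum q').mat :=
    (Matrix.MvN.fromBlocks h h').trans (Matrix.isStarProjection_fromBlocks p.isProj q.isProj)
      (p'.sum q').isProj (sum_mvN p' q')
  exact (sum_mvN p q).symm.trans (p.sum q).isProj (p'.sum q').isProj h1

theorem sum_comm (p q : MatProj A) : p.sum q ≈ q.sum p := by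
  have h := Matrix.MvN.submatrix (Matrix.isStarProjection_fromBlocks p.isProj q.isProj)
    (Equiv.sumComm (Fin q.size) (Fin p.size))
  have e : (Matrix.fromBlocks p.mat 0 0 q.mat).submatrix (Equiv.sumComm (Fin q.size) (Fin p.size))
      (Equiv.sumComm (Fin q.size) (Fin p.size)) = Matrix.fromBlocks q.mat 0 0 p.mat := by
    ext (i | i) (j | j) <;> simp
  rw [e] at h
  have h1 := h.trans (Matrix.isStarProjection_fromBlocks p.isProj q.isProj) (q.sum p).isProj (sum_mvN q p)
  exact (sum_mvN p q).symm.trans (p.sum q).isProj (q.sum p).isProj h1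

theorem zero_sum (p : MatProj A) : zero.sum p ≈ p := by
  have h := Matrix.MvN.submatrix p.isProj (Equiv.emptySum (Fin 0) (Fin p.size))
  have e : p.mat.submatrix (Equiv.emptySum (Fin 0) (Fin p.size)) (Equiv.emptySum (Fin 0) (Fin p.size))
      = Matrix.fromBlocks (0 : Matrix (Fin 0) (Fin 0) A) 0 0 p.mat := by
    ext (i | i) (j | j)
    · exact i.elim0
    · exact i.elim0
    · exact j.elim0
    · simp
  rw [e] at h
  exact (h.trans p.isProj (zero.sum p).isProj (sum_mvN zero p)).symm

theorem sum_assoc (p q r : MatProj A) : (p.sum q).sum r ≈ p.sum (q.sum r) := by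
  have pq := Matrix.isStarProjection_fromBlocks p.isProj q.isProj
  have qr := Matrix.isStarProjection_fromBlocks q.isProj r.isProj
  have L := Matrix.isStarProjection_fromBlocks pq r.isProj
  have R := Matrix.isStarProjection_fromBlocks p.isProj qr
  have hL : Matrix.MvN (Matrix.fromBlocks (Matrix.fromBlocks p.mat 0 0 q.mat) 0 0 r.mat)
      ((p.sum q).sum r).mat :=
    ((sum_mvN p q).fromBlocks (Matrix.MvN.refl r.isProj)).trans L ((p.sum q).sum r).isProj
      (sum_mvN (p.sum q) r)
  have hR : Matrix.MvN (Matrix.fromBlocks p.mat 0 0 (Matrix.fromBlocks q.mat 0 0 r.mat))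
      (p.sum (q.sum r)).mat :=
    ((Matrix.MvN.refl p.isProj).fromBlocks (sum_mvN q r)).trans R (p.sum (q.sum r)).isProj
      (sum_mvN p (q.sum r))
  have h := Matrix.MvN.submatrix R (Equiv.sumAssoc (Fin p.size) (Fin q.size) (Fin r.size))
  have e : (Matrix.fromBlocks p.mat 0 0 (Matrix.fromBlocks q.mat 0 0 r.mat)).submatrix
      (Equiv.sumAssoc (Fin p.size) (Fin q.size) (Fin r.size)) (Equiv.sumAssoc (Fin p.size) (Fin q.size) (Fin r.size))
      = Matrix.fromBlocks (Matrix.fromBlocks p.mat 0 0 q.mat) 0 0 r.mat := by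
    ext ((i | i) | i) ((j | j) | j) <;> simp
  rw [e] at h
  exact (hL.symm.trans ((p.sum q).sum r).isProj R h.symm).trans
    ((p.sum q).sum r).isProj (p.sum (q.sum r)).isProj hR

end MatProj

variable (A) in
/-- The Murray-von Neumann semigroup `V(A)`: equivalence classes of projections in the matrix
algebras over `A`. -/
def VMonoid : Type _ := Quotient (MatProj.setoid (A := A))

namespace VMonoid

/-- The class `[p]` of a projection of some `M_n(A)`. -/
def mk (p : MatProj A) : VMonoid A := Quotient.mk _ p

/-- Addition is induced by the direct sum of projections. -/
instance add : Add (VMonoid A) where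
  add := Quotient.map₂ MatProj.sum fun _ _ h _ _ h' => MatProj.sum_congr h h'

/-- The zero element is the class of the zero projection. -/
instance zero : Zero (VMonoid A) where
  zero := mk MatProj.zero

instance addCommMonoid : AddCommMonoid (VMonoid A) where
  add_assoc := by
    rintro ⟨p⟩ ⟨q⟩ ⟨r⟩
    exact Quotient.sound (MatProj.sum_assoc p q r)
  add_comm := by
    rintro ⟨p⟩ ⟨q⟩
    exact Quotient.sound (MatProj.sum_comm p q)
  zero_add := by
    rintro ⟨p⟩
    exact Quotient.sound (MatProj.zero_sum p)
  add_zero := by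
    rintro ⟨p⟩
    exact Quotient.sound (Setoid.trans (MatProj.sum_comm p MatProj.zero) (MatProj.zero_sum p))
  nsmul := nsmulRec

/-- `x ≤ y` in `V(A)`: `x + z = y` for some `z`. For classes of projections, this says that the
first projection is equivalent to a subprojection of the second one. -/
def Le (x y : VMonoid A) : Prop := ∃ z : VMonoid A, x + z = y

end VMonoid

variable (A) in
/-- The group `K₀(A)` of a unital C*-algebra `A`: the Grothendieck group of `V(A)`. -/
abbrev KZero : Type _ := Algebra.GrothendieckAddGroup (VMonoid A)

variable (A) in
/-- The positive cone `K₀(A)₊`: the image of `V(A)` in `K₀(A)`. -/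
def KZeroPos : AddSubmonoid (KZero A) :=
  AddMonoidHom.mrange (Algebra.GrothendieckAddGroup.of (M := VMonoid A))

/-- Murray-von Neumann equivalence of two elements (in practice, projections) of `A`. -/
def ProjEquiv (p q : A) : Prop := ∃ v : A, star v * v = p ∧ v * star v = q

end MurrayVonNeumann

section OrderedGroups

variable {G : Type*} [AddCommGroup G]

/-- `(G, P)` is an ordered abelian group with positive cone `P`:
`G = P - P` and `P ∩ (-P) = {0}`. The order is `x ≤ y ↔ y - x ∈ P`. -/
def IsOrderedGroup (P : AddSubmonoid G) : Prop :=
  (∀ x : G, ∃ a ∈ P, ∃ b ∈ P, x = a - b) ∧ ∀ x ∈ P, -x ∈ P → x = 0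

/-- Weak unperforation: if `n x > 0` for some integer `n > 0`, then `x > 0`
(where `y > 0` means `y ∈ P` and `y ≠ 0`). -/
def IsWeaklyUnperforated (P : AddSubmonoid G) : Prop :=
  ∀ (x : G) (n : ℕ), 0 < n → n • x ∈ P → n • x ≠ 0 → x ∈ P ∧ x ≠ 0

/-- The Riesz interpolation property: if `a₁, a₂ ≤ b₁, b₂`, then there is `c` with
`a₁, a₂ ≤ c ≤ b₁, b₂`. -/
def HasRieszInterpolation (P : AddSubmonoid G) : Prop :=
  ∀ a₁ a₂ b₁ b₂ : G, b₁ - a₁ ∈ P → b₂ - a₁ ∈ P → b₁ - a₂ ∈ P → b₂ - a₂ ∈ P →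
    ∃ c : G, c - a₁ ∈ P ∧ c - a₂ ∈ P ∧ b₁ - c ∈ P ∧ b₂ - c ∈ P

end OrderedGroups

section TAI

variable {A : Type*} [CStarAlgebra A]

variable (A) in
/-- A C*-algebra is simple if it is nonzero and has no closed two-sided ideals but `0` and `A`. -/
def IsSimpleCStarAlgebra : Prop :=
  Nontrivial A ∧ ∀ J : TwoSidedIdeal A, IsClosed (J : Set A) → J = ⊥ ∨ J = ⊤

/-- `a` is full: the closed two-sided ideal generated by `a` is `A`. -/
def IsFullElement (a : A) : Prop :=
  closure (TwoSidedIdeal.span {a} : Set A) = Set.univ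

/-- `p ≼ a`: the projection `p` is equivalent to a projection in the hereditary
C*-subalgebra `closure (a A a)`. -/
def ProjSubequiv (p a : A) : Prop :=
  ∃ q : A, IsStarProjection q ∧ q ∈ closure (Set.range fun x : A => a * x * a) ∧ ProjEquiv p q

/-- The C*-subalgebra `I` of `A` belongs to the class of the finite direct sums of algebras
`M_k(ℂ)` and `M_k(C([0,1]))`, `k ≥ 1`. -/
def IsIntervalSubalgebra (I : NonUnitalStarSubalgebra ℂ A) : Prop :=
  IsClosed (I : Set A) ∧
    ∃ (r s : ℕ) (k : Fin r → ℕ) (l : Fin s → ℕ), (∀ i, 0 < k i) ∧ (∀ j, 0 < l j) ∧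
      Nonempty (I ≃⋆ₐ[ℂ]
        (((i : Fin r) → Matrix (Fin (k i)) (Fin (k i)) ℂ) ×
          ((j : Fin s) → Matrix (Fin (l j)) (Fin (l j)) C(unitInterval, ℂ))))

variable (A) in
/-- The unital C*-algebra `A` is tracially approximately interval (TAI). -/
def IsTAI [PartialOrder A] [StarOrderedRing A] : Prop :=
  ∀ (F : Finset A) (b : A), b ∈ F → b ≠ 0 → ∀ ε : ℝ, 0 < ε → ∀ n : ℕ, 0 < n →
    ∀ a : A, 0 ≤ a → IsFullElement a →
      ∃ (p : A) (hp : IsStarProjection p) (I : NonUnitalStarSubalgebra ℂ A),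
        p ≠ 0 ∧ IsIntervalSubalgebra I ∧ (p ∈ I ∧ ∀ y ∈ I, p * y = y ∧ y * p = y) ∧
        (∀ x ∈ F, ‖x * p - p * x‖ < ε) ∧
        (∀ x ∈ F, ∃ y ∈ I, ‖p * x * p - y‖ < ε) ∧
        ‖b‖ - ε ≤ ‖p * b * p‖ ∧
        VMonoid.Le (n • VMonoid.mk (MatProj.single (1 - p) hp.one_sub))
          (VMonoid.mk (MatProj.single p hp)) ∧
        ProjSubequiv (1 - p) a

end TAI

/-! The TAI condition lets any finite set of relations in V(A) be tested in a free monoid `J → ℕ`,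
where order, cancellation and suprema are coordinatewise.

A cut. Represent finitely many classes by matrix projections, and the relations [X] + [Y] = [Z]
among them by rectangular partial isometries. Apply TAI to the entries of all these matrices: the
unit p of an interval algebra I almost commutes with them, and their corners almost lie in I.
Functional calculus then splits each X, up to equivalence, as a projection over I plus a projection
in the corner of 1 - p (`Matrix.exists_cut_of_l1Norm_le`), and the partial isometries descend to
equivalences over I (`Matrix.exists_mvN_cut_of_l1Norm_le`). Since V(I) is some `J → ℕ`
(`VMonoid.nonempty_addEquiv_intervalAlgebra`), this gives a map c, additive on the chosen finite
set, a homomorphism ψ back to V(A), and x = ψ(c x) + y with y at most a fixed multiple of u = [1 -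
p]. The norm condition on pbp gives c x₀ ≠ 0 for one prescribed nonzero x₀. All this is
`VMonoid.HasCut`, obtained in `IsTAI.exists_hasCut`.

Order. If x + y vanishes in K₀(A), then s + x + y = s for some s. Applying c and cancelling gives c
x = 0, hence x = 0.

Errors. The other two properties require the remainders y to be absorbed (`VMonoid.exists_cut`). If
cuts with u = 0 always exist, there are no remainders. Otherwise some cutting problem forces p ≠ 1;
posing it below an arbitrary nonzero positive element yields nonzero projections in every nonzero
hereditary subalgebra. With simplicity this produces a nonzero projection of which many copies fit
below all the prescribed nonzero classes, and its image under c supplies a d with n d ≤ c r for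
every prescribed r, while ψ(d) dominates K u in K₀(A).

Conclusion. If n p = n q + r with r ≠ 0, then c q + d ≤ c p coordinatewise, and ψ(d) absorbs the
remainder of q, so p - q is positive. For interpolation with strict inequalities, the supremum of c
p₀ and c p₁ plus d lies below each c q_j; lifting the supremum by ψ and adding both remainders gives
the interpolant. -/

/-! ### Perturbation of projections and of equivalences in a C*-algebra -/

section CStarAlgebra

variable {M : Type*} [CStarAlgebra M]

/-- An approximately idempotent self-adjoint element is close to a projection, which can be
factored through it on both sides. -/
theorem IsSelfAdjoint.exists_isStarProjection_near {a : M} (ha : IsSelfAdjoint a)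
    (h : ‖a * a - a‖ < 1 / 4) :
    ∃ e g : M, IsStarProjection e ∧ ‖e - a‖ ≤ 2 * ‖a * a - a‖ ∧ e = a * g ∧ e = g * a := by
  have hsp : ∀ t ∈ spectrum ℝ a, |t * t - t| ≤ ‖a * a - a‖ := by
    intro t ht
    have h1 : cfc (fun t : ℝ => t * t - t) a = a * a - a := by
      rw [cfc_sub (fun t : ℝ => t * t) (fun t => t) a, cfc_mul (fun t : ℝ => t) (fun t => t) a,
        cfc_id' ℝ a]
    have h2 := norm_apply_le_norm_cfc (fun t : ℝ => t * t - t) a ht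
    rwa [h1] at h2
  -- At t = 1/2 the value of |t² - t| is exactly 1/4. The resulting gap in the spectrum makes the
  -- step function at 1/2, and its quotient by t, continuous there.
  have hne : ∀ t ∈ spectrum ℝ a, t ≠ 1 / 2 := by
    rintro t ht rfl
    have := hsp _ ht
    norm_num [abs_of_neg] at this
    linarith
  have hloc : ∀ t ∈ spectrum ℝ a, ∀ c d : ℝ → ℝ, ContinuousAt c t → ContinuousAt d t →
      ContinuousWithinAt (fun t : ℝ => if 1 / 2 < t then c t else d t) (spectrum ℝ a) t := by
    intro t ht c d hc hd
    apply ContinuousAt.continuousWithinAt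
    rcases lt_or_gt_of_ne (hne t ht) with h1 | h1
    · refine hd.congr ?_
      filter_upwards [eventually_lt_nhds h1] with s hs
      rw [if_neg hs.not_gt]
    · refine hc.congr ?_
      filter_upwards [eventually_gt_nhds h1] with s hs
      rw [if_pos hs]
  have hf : ContinuousOn (fun t : ℝ => if 1 / 2 < t then (1 : ℝ) else 0) (spectrum ℝ a) :=
    fun t ht => hloc t ht _ _ continuousAt_const continuousAt_const
  have hg : ContinuousOn (fun t : ℝ => if 1 / 2 < t then t⁻¹ else 0) (spectrum ℝ a) := by
    intro t ht
    rcases lt_or_gt_of_ne (hne t ht) with h1 | h1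
    · apply ContinuousAt.continuousWithinAt
      refine (continuousAt_const : ContinuousAt (fun _ : ℝ => (0 : ℝ)) t).congr ?_
      filter_upwards [eventually_lt_nhds h1] with s hs
      rw [if_neg hs.not_gt]
    · exact hloc t ht _ _ (continuousAt_inv₀ (by linarith)) continuousAt_const
  refine ⟨cfc (fun t : ℝ => if 1 / 2 < t then (1 : ℝ) else 0) a,
    cfc (fun t : ℝ => if 1 / 2 < t then t⁻¹ else 0) a, ⟨?_, cfc_predicate _ a⟩, ?_, ?_, ?_⟩
  · change _ * _ = _
    rw [← cfc_mul _ _ a hf hf]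
    refine cfc_congr fun t _ => ?_
    split_ifs <;> simp
  · have : cfc (fun t : ℝ => if 1 / 2 < t then (1 : ℝ) else 0) a - a =
        cfc (fun t : ℝ => (if 1 / 2 < t then (1 : ℝ) else 0) - t) a := by
      rw [cfc_sub _ (fun t => t) a hf continuousOn_id, cfc_id' ℝ a]
    rw [this]
    refine norm_cfc_le (by positivity) fun t ht => ?_
    refine le_trans ?_ (mul_le_mul_of_nonneg_left (hsp t ht) zero_le_two)
    rw [Real.norm_eq_abs, show t * t - t = t * (t - 1) by ring, abs_mul]
    split_ifs with h1
    · rw [abs_sub_comm]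
      have := abs_of_pos (show (0 : ℝ) < t by linarith)
      nlinarith [abs_nonneg (t - 1)]
    · rw [zero_sub, abs_neg, abs_of_nonpos (show t - 1 ≤ 0 by linarith)]
      nlinarith [abs_nonneg t]
  · conv_rhs => enter [1]; rw [← cfc_id' ℝ a]
    rw [← cfc_mul (fun t => t) _ a continuousOn_id hg]
    refine cfc_congr fun t _ => ?_
    split_ifs with h1
    · rw [mul_inv_cancel₀ (by linarith)]
    · simp
  · conv_rhs => enter [2]; rw [← cfc_id' ℝ a]
    rw [← cfc_mul _ (fun t => t) a hg continuousOn_id]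
    refine cfc_congr fun t _ => ?_
    split_ifs with h1
    · rw [inv_mul_cancel₀ (by linarith)]
    · simp

/-- If `s t` is close to a projection `q`, then `q` is equivalent to a projection onto a part of
the range of `t`. -/
theorem IsStarProjection.exists_mul_of_norm_sub_lt {q s t : M} (hq : IsStarProjection q)
    (h : ‖q - s * t‖ < 1) :
    ∃ z y : M, star (t * z) * (t * z) = q ∧ t * z * q = t * z ∧ t * z * y = t * q := by
  let _ : PartialOrder M := CStarAlgebra.spectralOrder M
  have _ : StarOrderedRing M := CStarAlgebra.spectralOrderedRing M
  have hqs : star q = q := hq.isSelfAdjoint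
  have hqq : q * q = q := hq.isIdempotentElem
  cases subsingleton_or_nontrivial M
  · exact ⟨0, 0, Subsingleton.elim _ _, Subsingleton.elim _ _, Subsingleton.elim _ _⟩
  set b := q * star t * t * q with hb
  -- Adding 1 - q turns invertibility in the corner of q into invertibility in M. The element m is
  -- invertible by a Neumann series and m*m ≤ K c, so c is invertible; the factor c^(-1/2) then
  -- performs the polar decomposition of t q.
  set c := b + (1 - q) with hc
  set m := q * s * t * q + (1 - q) with hm
  have hmu : IsUnit m := by
    have : m = 1 - q * (q - s * t) * q := by
      rw [hm]; simp only [mul_sub, sub_mul, hqq, ← mul_assoc]; abel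
    rw [this]
    refine isUnit_one_sub_of_norm_lt_one ?_
    have hq1 : ‖q‖ ≤ 1 := hq.norm_le
    calc ‖q * (q - s * t) * q‖ ≤ ‖q‖ * ‖q - s * t‖ * ‖q‖ :=
          (norm_mul_le _ _).trans (mul_le_mul_of_nonneg_right (norm_mul_le _ _) (norm_nonneg _))
      _ ≤ 1 * ‖q - s * t‖ * 1 := by gcongr
      _ < 1 := by simpa using h
  have hc0 : 0 ≤ c := by
    refine add_nonneg ?_ hq.one_sub.nonneg
    have : b = star (t * q) * (t * q) := by rw [star_mul, hqs, hb]; simp only [mul_assoc]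
    rw [this]; exact star_mul_self_nonneg _
  have hcu : IsUnit c := by
    obtain ⟨K, hK1, hK⟩ : ∃ K : ℝ, 1 ≤ K ∧ ‖s‖ ^ 2 ≤ K :=
      ⟨max 1 (‖s‖ ^ 2), le_max_left _ _, le_max_right _ _⟩
    have h1 : star m * m ≤ K • c := by
      have e1 : star m * m = star (t * q) * (star s * q * s) * (t * q) + (1 - q) := by
        simp only [hm, star_add, star_sub, star_mul, hqs, star_one, mul_add, add_mul, mul_sub, sub_mul,
          mul_one, one_mul, mul_assoc, hqq]
        simp only [← mul_assoc, hqq]; simp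
      have e2 : star s * q * s ≤ K • (1 : M) := by
        have : star s * q * s ≤ algebraMap ℝ M ‖star s * q * s‖ := by
          refine IsSelfAdjoint.le_algebraMap_norm_self ?_
          rw [IsSelfAdjoint, star_mul, star_mul, star_star, hqs, mul_assoc]
        refine this.trans ?_
        rw [Algebra.algebraMap_eq_smul_one]
        refine smul_le_smul_of_nonneg_right ?_ zero_le_one
        calc ‖star s * q * s‖ ≤ ‖s‖ * 1 * ‖s‖ := by
              refine (norm_mul_le _ _).trans (mul_le_mul_of_nonneg_right ?_ (norm_nonneg _))
              refine (norm_mul_le _ _).trans ?_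
              rw [norm_star]; gcongr; exact hq.norm_le
          _ ≤ K := by rw [mul_one, ← sq]; exact hK
      have e3 : star (t * q) * (star s * q * s) * (t * q) ≤ star (t * q) * (K • (1 : M)) * (t * q) :=
        star_left_conjugate_le_conjugate e2 _
      have e4 : star (t * q) * (K • (1 : M)) * (t * q) = K • b := by
        rw [hb, star_mul, hqs]; simp only [mul_smul_comm, smul_mul_assoc, mul_one, mul_assoc]
      rw [e1, hc, smul_add]
      refine add_le_add (e4 ▸ e3) ?_
      conv_lhs => rw [← one_smul ℝ (1 - q)]
      exact smul_le_smul_of_nonneg_right hK1 hq.one_sub.nonneg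
    have h2 : IsStrictlyPositive (star m * m) :=
      ⟨star_mul_self_nonneg m, (hmu.star).mul hmu⟩
    have h3 : IsUnit (K • c) := CStarAlgebra.isUnit_of_le _ h1
    have : c = K⁻¹ • (K • c) := by rw [smul_smul, inv_mul_cancel₀ (by linarith), one_smul]
    rw [this]
    rw [← one_mul (K • c), ← smul_mul_assoc, ← Algebra.algebraMap_eq_smul_one]
    exact ((IsUnit.mk0 K⁻¹ (by positivity)).map (algebraMap ℝ M)).mul h3
  have hcp : IsStrictlyPositive c := ⟨hc0, hcu⟩
  have hcq : c * q = b := by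
    rw [hc, hb, add_mul, sub_mul, one_mul, hqq, sub_self, add_zero, mul_assoc, hqq]
  have hqc : q * c = b := by
    rw [hc, hb, mul_add, mul_sub, mul_one, hqq, sub_self, add_zero, ← mul_assoc, ← mul_assoc,
      ← mul_assoc, hqq]
  have hcomm : ∀ r : ℝ, Commute (c ^ r) q := fun r =>
    Commute.cfc_nnreal (show Commute c q by rw [commute_iff_eq, hcq, hqc]) _
  have hgs : star (c ^ (-1 / 2 : ℝ)) = c ^ (-1 / 2 : ℝ) := IsSelfAdjoint.of_nonneg CFC.rpow_nonneg
  have hgcg : c ^ (-1 / 2 : ℝ) * c * c ^ (-1 / 2 : ℝ) = 1 := by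
    conv_lhs => enter [1, 2]; rw [← CFC.rpow_one c]
    rw [← CFC.rpow_add hcu, ← CFC.rpow_add hcu]
    norm_num [CFC.rpow_zero c]
  refine ⟨q * c ^ (-1 / 2 : ℝ), c ^ (1 / 2 : ℝ), ?_, ?_, ?_⟩
  · calc star (t * (q * c ^ (-1 / 2 : ℝ))) * (t * (q * c ^ (-1 / 2 : ℝ)))
        = c ^ (-1 / 2 : ℝ) * b * c ^ (-1 / 2 : ℝ) := by
          simp only [star_mul, hgs, hqs, hb, mul_assoc]
      _ = c ^ (-1 / 2 : ℝ) * c * (q * c ^ (-1 / 2 : ℝ)) := by rw [← hcq]; simp only [mul_assoc]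
      _ = q := by rw [← (hcomm _).eq, ← mul_assoc, hgcg, one_mul]
  · rw [mul_assoc, mul_assoc, (hcomm _).eq, ← mul_assoc q, hqq]
  · rw [mul_assoc, mul_assoc, ← CFC.rpow_add hcu]
    norm_num [CFC.rpow_zero c]

/-- Two projections which are almost equivalent are equivalent. -/
theorem IsStarProjection.projEquiv_of_norm_sub_lt {e f w : M} (he : IsStarProjection e)
    (hf : IsStarProjection f) (h1 : ‖e - e * star w * f * w * e‖ < 1)
    (h2 : ‖f - f * w * e * star w * f‖ < 1) : ∃ v : M, star v * v = e ∧ v * star v = f := by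
  have hee : e * e = e := he.isIdempotentElem
  have hff : f * f = f := hf.isIdempotentElem
  have hfs : star f = f := hf.isSelfAdjoint
  obtain ⟨z, y, h3, h4, h5⟩ := he.exists_mul_of_norm_sub_lt (s := e * star w * f) (t := f * w * e)
    (by convert h1 using 3; simp only [← mul_assoc]; rw [mul_assoc (e * star w), hff])
  set v := f * w * e * z with hv
  refine ⟨v, h3, ?_⟩
  have hfv : f * v = v := by rw [hv]; simp only [← mul_assoc, hff]
  have hvf : star v * f = star v := by rw [← hfs, ← star_mul, hfv]
  -- The defect d kills v, hence f w e = v y, so d = d (f - f w e w* f). The second norm bound then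
  -- forces d = 0.
  set d := f - v * star v with hd
  have hdv : d * v = 0 := by rw [hd, sub_mul, hfv, mul_assoc, h3, h4, sub_self]
  have hdw : d * (f * w * e) = 0 := by
    have : f * w * e = v * y := by rw [h5, mul_assoc _ e e, hee]
    rw [this, ← mul_assoc, hdv, zero_mul]
  have hdf : d * f = d := by rw [hd, sub_mul, hff, mul_assoc, hvf]
  have h6 : d = d * (f - f * w * e * star w * f) := by
    rw [mul_sub, hdf]
    have : d * (f * w * e * star w * f) = d * (f * w * e) * star w * f := by simp only [mul_assoc]
    rw [this, hdw, zero_mul, zero_mul, sub_zero]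
  have h7 : ‖d‖ ≤ ‖d‖ * ‖f - f * w * e * star w * f‖ := by
    conv_lhs => rw [h6]
    exact norm_mul_le _ _
  have h8 : ‖d‖ = 0 := by
    by_contra h
    have : 0 < ‖d‖ := lt_of_le_of_ne (norm_nonneg _) (Ne.symm h)
    nlinarith
  exact (sub_eq_zero.mp (norm_eq_zero.mp h8)).symm

/-- Projections at distance less than one are equivalent. -/
theorem IsStarProjection.projEquiv_of_norm_sub_lt_one {e f : M} (he : IsStarProjection e)
    (hf : IsStarProjection f) (h : ‖e - f‖ < 1) : ∃ v : M, star v * v = e ∧ v * star v = f := by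
  have key : ∀ e f : M, IsStarProjection e → IsStarProjection f → ‖e - f‖ < 1 →
      ‖e - e * star 1 * f * 1 * e‖ < 1 := by
    intro e f he hf h
    have hee : e * e = e := he.isIdempotentElem
    have : e - e * star 1 * f * 1 * e = e * (e - f) * e := by
      simp only [star_one, mul_one, mul_sub, sub_mul, hee]
    rw [this]
    calc ‖e * (e - f) * e‖ ≤ ‖e‖ * ‖e - f‖ * ‖e‖ :=
          (norm_mul_le _ _).trans (mul_le_mul_of_nonneg_right (norm_mul_le _ _) (norm_nonneg _))
      _ ≤ 1 * ‖e - f‖ * 1 := by gcongr <;> exact he.norm_le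
      _ < 1 := by simpa using h
  refine he.projEquiv_of_norm_sub_lt hf (w := 1) (key e f he hf h) ?_
  have := key f e hf he (by rwa [norm_sub_rev])
  simpa using this

end CStarAlgebra

section CStarAlgebra

variable {M : Type*} [CStarAlgebra M]

/-- Two projections which are approximately `star w * w` and `w * star w` are equivalent. -/
theorem IsStarProjection.projEquiv_of_norm_star_mul_self_sub_le {e f w : M}
    (he : IsStarProjection e) (hf : IsStarProjection f) (h1 : ‖star w * w - e‖ ≤ 1 / 8)
    (h2 : ‖w * star w - f‖ ≤ 1 / 8) : ∃ v : M, star v * v = e ∧ v * star v = f := by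
  have key : ∀ e f w : M, IsStarProjection e → IsStarProjection f → ‖star w * w - e‖ ≤ 1 / 8 →
      ‖w * star w - f‖ ≤ 1 / 8 → ‖e - e * star w * f * w * e‖ < 1 := by
    intro e f w he hf h1 h2
    have hee : e * e = e := he.isIdempotentElem
    have he1 : ‖e‖ ≤ 1 := he.norm_le
    have hw : ‖star w * w‖ ≤ 2 := by
      have := norm_le_norm_sub_add (star w * w) e
      linarith
    have hw2 : ‖w‖ * ‖w‖ ≤ 2 := by rwa [CStarRing.norm_star_mul_self] at hw
    -- With tolerance 1/8, the three error terms are at most 1/4, 1/4 and 1/8, which sum to less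
    -- than 1.
    have e1 : e - e * star w * f * w * e = e * (star w * (w * star w - f) * w -
        (star w * w - e) * (star w * w) - e * (star w * w - e)) * e := by
      simp only [mul_sub, sub_mul, hee, mul_assoc]
      simp only [← mul_assoc, hee]
      abel
    have b1 : ‖star w * (w * star w - f) * w‖ ≤ 1 / 4 := by
      calc ‖star w * (w * star w - f) * w‖ ≤ ‖star w‖ * ‖w * star w - f‖ * ‖w‖ :=
            (norm_mul_le _ _).trans (mul_le_mul_of_nonneg_right (norm_mul_le _ _) (norm_nonneg _))
        _ = ‖w‖ * ‖w‖ * ‖w * star w - f‖ := by rw [norm_star]; ring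
        _ ≤ 2 * (1 / 8) := by gcongr
        _ = 1 / 4 := by norm_num
    have b2 : ‖(star w * w - e) * (star w * w)‖ ≤ 1 / 4 :=
      calc _ ≤ ‖star w * w - e‖ * ‖star w * w‖ := norm_mul_le _ _
        _ ≤ 1 / 8 * 2 := by gcongr
        _ = 1 / 4 := by norm_num
    have b3 : ‖e * (star w * w - e)‖ ≤ 1 / 8 :=
      calc _ ≤ ‖e‖ * ‖star w * w - e‖ := norm_mul_le _ _
        _ ≤ 1 * (1 / 8) := by gcongr
        _ = 1 / 8 := by norm_num
    rw [e1]
    set x := star w * (w * star w - f) * w - (star w * w - e) * (star w * w) -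
      e * (star w * w - e) with hx
    have b4 : ‖x‖ ≤ 5 / 8 := by
      have := norm_sub_le (star w * (w * star w - f) * w - (star w * w - e) * (star w * w))
        (e * (star w * w - e))
      have := norm_sub_le (star w * (w * star w - f) * w) ((star w * w - e) * (star w * w))
      linarith
    calc ‖e * x * e‖ ≤ ‖e‖ * ‖x‖ * ‖e‖ :=
          (norm_mul_le _ _).trans (mul_le_mul_of_nonneg_right (norm_mul_le _ _) (norm_nonneg _))
      _ ≤ 1 * (5 / 8) * 1 := by gcongr
      _ < 1 := by norm_num
  refine he.projEquiv_of_norm_sub_lt hf (w := w) (key e f w he hf h1 h2) ?_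
  have := key f e (star w) hf he (by rwa [star_star]) (by rwa [star_star])
  rwa [star_star] at this

end CStarAlgebra

/-! ### The entrywise ℓ¹ norm, and perturbation results for rectangular matrices -/

namespace Matrix

section L1Norm

variable {A : Type*} [NormedRing A] {k m n : Type*} [Fintype k] [Fintype m] [Fintype n]

/-- The sum of the norms of the entries of a matrix. -/
noncomputable def l1Norm (X : Matrix m n A) : ℝ := ∑ i, ∑ j, ‖X i j‖

theorem l1Norm_nonneg (X : Matrix m n A) : 0 ≤ X.l1Norm :=
  Finset.sum_nonneg fun _ _ => Finset.sum_nonneg fun _ _ => norm_nonneg _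

theorem norm_entry_le_l1Norm (X : Matrix m n A) (i : m) (j : n) : ‖X i j‖ ≤ X.l1Norm :=
  (Finset.single_le_sum (f := fun j => ‖X i j‖) (fun _ _ => norm_nonneg _) (Finset.mem_univ j)).trans
    (Finset.single_le_sum (f := fun i => ∑ j, ‖X i j‖)
      (fun _ _ => Finset.sum_nonneg fun _ _ => norm_nonneg _) (Finset.mem_univ i))

theorem l1Norm_le_of_norm_entry_le {X : Matrix m n A} {c : ℝ} (h : ∀ i j, ‖X i j‖ ≤ c) :
    X.l1Norm ≤ Fintype.card m * Fintype.card n * c := by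
  calc X.l1Norm ≤ ∑ _ : m, ∑ _ : n, c :=
        Finset.sum_le_sum fun i _ => Finset.sum_le_sum fun j _ => h i j
    _ = _ := by simp [mul_assoc]

theorem l1Norm_add_le (X Y : Matrix m n A) : (X + Y).l1Norm ≤ X.l1Norm + Y.l1Norm := by
  simp only [l1Norm, ← Finset.sum_add_distrib]
  exact Finset.sum_le_sum fun i _ => Finset.sum_le_sum fun j _ => norm_add_le _ _

theorem l1Norm_neg (X : Matrix m n A) : (-X).l1Norm = X.l1Norm := by simp [l1Norm]

theorem l1Norm_sub_le (X Y : Matrix m n A) : (X - Y).l1Norm ≤ X.l1Norm + Y.l1Norm := by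
  rw [sub_eq_add_neg, ← l1Norm_neg Y]; exact l1Norm_add_le _ _

theorem l1Norm_mul_le (X : Matrix k m A) (Y : Matrix m n A) :
    (X * Y).l1Norm ≤ X.l1Norm * Y.l1Norm := by
  calc (X * Y).l1Norm ≤ ∑ i, ∑ j, ∑ l, ‖X i l‖ * ‖Y l j‖ :=
        Finset.sum_le_sum fun i _ => Finset.sum_le_sum fun j _ =>
          (norm_sum_le _ _).trans (Finset.sum_le_sum fun l _ => norm_mul_le _ _)
    _ = ∑ i, ∑ l, ‖X i l‖ * ∑ j, ‖Y l j‖ := by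
        refine Finset.sum_congr rfl fun i _ => ?_
        rw [Finset.sum_comm]
        simp only [Finset.mul_sum]
    _ ≤ ∑ i, ∑ l, ‖X i l‖ * Y.l1Norm := by
        refine Finset.sum_le_sum fun i _ => Finset.sum_le_sum fun l _ => ?_
        refine mul_le_mul_of_nonneg_left ?_ (norm_nonneg _)
        exact Finset.single_le_sum (f := fun i => ∑ j, ‖Y i j‖)
          (fun _ _ => Finset.sum_nonneg fun _ _ => norm_nonneg _) (Finset.mem_univ l)
    _ = _ := by simp only [l1Norm, Finset.sum_mul]

theorem l1Norm_conjTranspose [StarRing A] [NormedStarGroup A] (X : Matrix m n A) :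
    Xᴴ.l1Norm = X.l1Norm := by
  simp only [l1Norm, conjTranspose_apply, norm_star]
  exact Finset.sum_comm

theorem l1Norm_diagonal_le [DecidableEq m] {a : A} (ha : ‖a‖ ≤ 1) :
    (diagonal fun _ : m => a).l1Norm ≤ Fintype.card m := by
  calc (diagonal fun _ : m => a).l1Norm ≤ ∑ _ : m, (1 : ℝ) := by
        refine Finset.sum_le_sum fun i _ => ?_
        rw [Finset.sum_eq_single i]
        · simpa using ha
        · intro j _ hj
          simp [diagonal_apply_ne' _ hj]
        · simp
    _ = _ := by simp

theorem l1Norm_fromBlocks {m' n' : Type*} [Fintype m'] [Fintype n'] (X : Matrix m n A)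
    (Y : Matrix m n' A) (Z : Matrix m' n A) (T : Matrix m' n' A) :
    (fromBlocks X Y Z T).l1Norm = X.l1Norm + Y.l1Norm + Z.l1Norm + T.l1Norm := by
  simp only [l1Norm, Fintype.sum_sum_type, fromBlocks_apply₁₁, fromBlocks_apply₁₂,
    fromBlocks_apply₂₁, fromBlocks_apply₂₂, Finset.sum_add_distrib]
  ring

theorem l1Norm_zero : (0 : Matrix m n A).l1Norm = 0 := by simp [l1Norm]

theorem l1Norm_map {B F : Type*} [NormedRing B] [FunLike F A B] {φ : F} (hφ : ∀ a, ‖φ a‖ = ‖a‖)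
    (X : Matrix m n A) : (X.map φ).l1Norm = X.l1Norm := by
  simp [l1Norm, hφ]

end L1Norm

section CStar

variable {A : Type*} [CStarAlgebra A] {m n : Type*} [Fintype m] [Fintype n]

-- The C*-norm of a matrix is an operator norm on a Hilbert module, so it is bounded by summing over
-- entries. As each entry is in turn bounded by the C*-norm, the C*-algebraic perturbation lemmas
-- can be restated in `l1Norm`, which makes sense for all shapes and is preserved by isometric maps
-- of the entries.
open WithCStarModule in
theorem norm_ofMatrix_le_l1Norm [PartialOrder A] [StarOrderedRing A] (X : Matrix m n A) :
    ‖CStarMatrix.ofMatrix X‖ ≤ X.l1Norm := by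
  rw [l1Norm, Finset.sum_comm, CStarMatrix.norm_def]
  refine ContinuousLinearMap.opNorm_le_bound _ (by positivity) fun v => ?_
  simp only [CStarMatrix.toCLM_apply_eq_sum, Finset.sum_mul]
  refine (pi_norm_le_sum_norm _).trans ?_
  gcongr with i _
  refine (norm_sum_le _ _).trans ?_
  gcongr with j _
  refine (norm_mul_le _ _).trans ?_
  rw [mul_comm]
  gcongr
  · rfl
  · exact norm_apply_le_norm v j

/-- The factor `Fintype.card m * Fintype.card m` is the price of returning from the C*-norm to
`l1Norm` through the entries. -/
theorem exists_isStarProjection_near [DecidableEq m] {H : Matrix m m A} (hH : Hᴴ = H)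
    (h : (H * H - H).l1Norm < 1 / 4) :
    ∃ E G : Matrix m m A, IsStarProjection E ∧ E = H * G ∧ E = G * H ∧
      (E - H).l1Norm ≤ Fintype.card m * Fintype.card m * (2 * (H * H - H).l1Norm) := by
  let _ : PartialOrder A := CStarAlgebra.spectralOrder A
  have _ : StarOrderedRing A := CStarAlgebra.spectralOrderedRing A
  have h0 := norm_ofMatrix_le_l1Norm (H * H - H)
  obtain ⟨E, G, h1, h2, h3, h4⟩ := IsSelfAdjoint.exists_isStarProjection_near
    (a := CStarMatrix.ofMatrix H) hH (h0.trans_lt h)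
  refine ⟨E, G, ⟨h1.1, h1.2⟩, h3, h4, l1Norm_le_of_norm_entry_le fun i j => ?_⟩
  refine le_trans ?_ (h2.trans (mul_le_mul_of_nonneg_left h0 zero_le_two))
  exact CStarMatrix.norm_entry_le_norm (M := E - CStarMatrix.ofMatrix H)

theorem exists_mul_of_l1Norm_sub_lt [DecidableEq m] {q s t : Matrix m m A}
    (hq : IsStarProjection q) (h : (q - s * t).l1Norm < 1) :
    ∃ z : Matrix m m A, (t * z)ᴴ * (t * z) = q := by
  let _ : PartialOrder A := CStarAlgebra.spectralOrder A
  have _ : StarOrderedRing A := CStarAlgebra.spectralOrderedRing A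
  obtain ⟨z, _, hz, _⟩ := IsStarProjection.exists_mul_of_norm_sub_lt
    (q := CStarMatrix.ofMatrix q) (s := CStarMatrix.ofMatrix s) (t := CStarMatrix.ofMatrix t)
    ⟨hq.1, hq.2⟩ ((norm_ofMatrix_le_l1Norm (q - s * t)).trans_lt h)
  exact ⟨z, hz⟩

theorem MvN.of_l1Norm_sub_lt_one {X Y : Matrix m m A} (hX : IsStarProjection X)
    (hY : IsStarProjection Y) (h : (X - Y).l1Norm < 1) : MvN X Y := by
  classical
  let _ : PartialOrder A := CStarAlgebra.spectralOrder A
  have _ : StarOrderedRing A := CStarAlgebra.spectralOrderedRing A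
  exact IsStarProjection.projEquiv_of_norm_sub_lt_one
    (e := CStarMatrix.ofMatrix X) (f := CStarMatrix.ofMatrix Y)
    ⟨hX.1, hX.2⟩ ⟨hY.1, hY.2⟩ ((norm_ofMatrix_le_l1Norm (X - Y)).trans_lt h)

theorem MvN.fromBlocks_left {A : Type*} [Ring A] [StarRing A] {X : Matrix m m A}
    (hX : IsStarProjection X) : MvN X (Matrix.fromBlocks X 0 0 (0 : Matrix n n A)) := by
  have h1 : Xᴴ = X := hX.isSelfAdjoint
  have h2 : X * X = X := hX.isIdempotentElem
  refine ⟨fromRows X 0, ?_, ?_⟩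
  · simp [conjTranspose_fromRows_eq_fromCols_conjTranspose, fromCols_mul_fromRows, h1, h2]
  · simp only [conjTranspose_fromRows_eq_fromCols_conjTranspose, fromRows_mul_fromCols,
      conjTranspose_zero, h1, h2, Matrix.mul_zero, Matrix.zero_mul]

theorem MvN.fromBlocks_right {A : Type*} [Ring A] [StarRing A] {X : Matrix m m A}
    (hX : IsStarProjection X) : MvN X (Matrix.fromBlocks (0 : Matrix n n A) 0 0 X) := by
  have h1 : Xᴴ = X := hX.isSelfAdjoint
  have h2 : X * X = X := hX.isIdempotentElem
  refine ⟨fromRows 0 X, ?_, ?_⟩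
  · simp [conjTranspose_fromRows_eq_fromCols_conjTranspose, fromCols_mul_fromRows, h1, h2]
  · simp only [conjTranspose_fromRows_eq_fromCols_conjTranspose, fromRows_mul_fromCols,
      conjTranspose_zero, h1, h2, Matrix.mul_zero, Matrix.zero_mul]

theorem MvN.of_l1Norm_sub_le_of_square {X Y W : Matrix m m A} (hX : IsStarProjection X)
    (hY : IsStarProjection Y) (h1 : (Wᴴ * W - X).l1Norm ≤ 1 / 8)
    (h2 : (W * Wᴴ - Y).l1Norm ≤ 1 / 8) : MvN X Y := by
  classical
  let _ : PartialOrder A := CStarAlgebra.spectralOrder A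
  have _ : StarOrderedRing A := CStarAlgebra.spectralOrderedRing A
  exact IsStarProjection.projEquiv_of_norm_star_mul_self_sub_le
    (e := CStarMatrix.ofMatrix X) (f := CStarMatrix.ofMatrix Y) (w := CStarMatrix.ofMatrix W)
    ⟨hX.1, hX.2⟩ ⟨hY.1, hY.2⟩ ((norm_ofMatrix_le_l1Norm (Wᴴ * W - X)).trans h1)
    ((norm_ofMatrix_le_l1Norm (W * Wᴴ - Y)).trans h2)

/-- Placing W in the lower left corner of a square matrix indexed by m ⊕ n reduces the rectangular
case to the square one. -/
theorem MvN.of_l1Norm_conjTranspose_mul_self_sub_le {X : Matrix m m A} {Y : Matrix n n A}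
    {W : Matrix n m A} (hX : IsStarProjection X) (hY : IsStarProjection Y)
    (h1 : (Wᴴ * W - X).l1Norm ≤ 1 / 8) (h2 : (W * Wᴴ - Y).l1Norm ≤ 1 / 8) : MvN X Y := by
  have hE := isStarProjection_fromBlocks hX (IsStarProjection.zero (Matrix n n A))
  have hF := isStarProjection_fromBlocks (IsStarProjection.zero (Matrix m m A)) hY
  have hEF : MvN (Matrix.fromBlocks X 0 0 (0 : Matrix n n A)) (Matrix.fromBlocks (0 : Matrix m m A) 0 0 Y) := by
    have e1 : (Matrix.fromBlocks 0 0 W (0 : Matrix n n A))ᴴ * Matrix.fromBlocks (0 : Matrix m m A) 0 W 0 -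
        Matrix.fromBlocks X 0 0 0 = Matrix.fromBlocks (Wᴴ * W - X) 0 0 0 := by
      simp [fromBlocks_conjTranspose, fromBlocks_multiply, sub_eq_add_neg, fromBlocks_neg, fromBlocks_add]
    have e2 : Matrix.fromBlocks (0 : Matrix m m A) 0 W 0 * (Matrix.fromBlocks 0 0 W (0 : Matrix n n A))ᴴ -
        Matrix.fromBlocks 0 0 0 Y = Matrix.fromBlocks 0 0 0 (W * Wᴴ - Y) := by
      simp [fromBlocks_conjTranspose, fromBlocks_multiply, sub_eq_add_neg, fromBlocks_neg, fromBlocks_add]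
    refine MvN.of_l1Norm_sub_le_of_square hE hF (W := Matrix.fromBlocks 0 0 W 0) ?_ ?_
    · rw [e1]; simpa [l1Norm_fromBlocks, l1Norm_zero] using h1
    · rw [e2]; simpa [l1Norm_fromBlocks, l1Norm_zero] using h2
  exact ((MvN.fromBlocks_left hX).trans hX hF hEF).trans hX hY (MvN.fromBlocks_right hY).symm

end CStar

end Matrix

/-! ### Calculus of classes in V(A), and functoriality for homomorphisms that need not be unital -/

section StarRing

variable {A : Type*} [Ring A] [StarRing A]

namespace Matrix

variable {m n : Type*} [Fintype m] [Fintype n]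

theorem MvN.add_of_mul_eq_zero {X Y : Matrix m m A} (hX : IsStarProjection X)
    (hY : IsStarProjection Y) (h : X * Y = 0) : MvN (Matrix.fromBlocks X 0 0 Y) (X + Y) := by
  have h1 : Xᴴ = X := hX.isSelfAdjoint
  have h2 : X * X = X := hX.isIdempotentElem
  have h3 : Yᴴ = Y := hY.isSelfAdjoint
  have h4 : Y * Y = Y := hY.isIdempotentElem
  have h5 : Y * X = 0 := by rw [← h1, ← h3, ← conjTranspose_mul, h, conjTranspose_zero]
  refine ⟨fromCols X Y, ?_, ?_⟩
  · simp [conjTranspose_fromCols_eq_fromRows_conjTranspose, h, h1, h2, h3, h4, h5]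
  · simp [conjTranspose_fromCols_eq_fromRows_conjTranspose, fromCols_mul_fromRows, h1, h2, h3, h4]

theorem isStarProjection_single [DecidableEq m] (i : m) {p : A} (hp : IsStarProjection p) :
    IsStarProjection (single i i p) := by
  have h1 : star p = p := hp.isSelfAdjoint
  have h2 : p * p = p := hp.isIdempotentElem
  refine ⟨?_, ?_⟩
  · change _ * _ = _
    simp [h2]
  · change (single i i p)ᴴ = _
    simp [h1]

theorem isStarProjection_diagonal [DecidableEq m] {d : m → A} (hd : ∀ i, IsStarProjection (d i)) :
    IsStarProjection (diagonal d) := by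
  refine ⟨?_, ?_⟩
  · change _ * _ = _
    rw [diagonal_mul_diagonal]
    exact congrArg _ (funext fun i => (hd i).isIdempotentElem)
  · change (diagonal d)ᴴ = _
    rw [diagonal_conjTranspose]
    exact congrArg _ (funext fun i => (hd i).isSelfAdjoint)

end Matrix

namespace VMonoid

open Matrix

variable {l m n : Type*} [Fintype l] [Fintype m] [Fintype n]

/-- The class of a projection in a matrix algebra with an arbitrary finite index type. -/
noncomputable def cls (X : Matrix m m A) (hX : IsStarProjection X) : VMonoid A :=
  mk ⟨Fintype.card m, X.submatrix (Fintype.equivFin m).symm (Fintype.equivFin m).symm,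
    isStarProjection_submatrix hX _⟩

theorem cls_eq_iff {X : Matrix m m A} {Y : Matrix n n A} {hX : IsStarProjection X}
    {hY : IsStarProjection Y} : cls X hX = cls Y hY ↔ MvN X Y := by
  have h1 := MvN.submatrix hX (Fintype.equivFin m).symm
  have h2 := MvN.submatrix hY (Fintype.equivFin n).symm
  have p1 := isStarProjection_submatrix hX (Fintype.equivFin m).symm
  have p2 := isStarProjection_submatrix hY (Fintype.equivFin n).symm
  constructor
  · intro h
    exact (h1.trans hX p2 (Quotient.exact h)).trans hX hY h2.symm
  · intro h
    exact Quotient.sound ((h1.symm.trans p1 hY h).trans p1 p2 h2)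

theorem mk_eq_cls (p : MatProj A) : mk p = cls p.mat p.isProj :=
  Quotient.sound (MvN.submatrix p.isProj _)

theorem exists_eq_cls (x : VMonoid A) :
    ∃ (k : ℕ) (X : Matrix (Fin k) (Fin k) A) (hX : IsStarProjection X), x = cls X hX := by
  obtain ⟨p⟩ := x
  exact ⟨p.size, p.mat, p.isProj, mk_eq_cls p⟩

theorem cls_fromBlocks {X : Matrix m m A} {Y : Matrix n n A} (hX : IsStarProjection X)
    (hY : IsStarProjection Y) :
    cls (Matrix.fromBlocks X 0 0 Y) (isStarProjection_fromBlocks hX hY) = cls X hX + cls Y hY := by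
  set P : MatProj A := ⟨Fintype.card m, X.submatrix (Fintype.equivFin m).symm (Fintype.equivFin m).symm,
    isStarProjection_submatrix hX _⟩
  set Q : MatProj A := ⟨Fintype.card n, Y.submatrix (Fintype.equivFin n).symm (Fintype.equivFin n).symm,
    isStarProjection_submatrix hY _⟩
  have h : cls X hX + cls Y hY = mk (P.sum Q) := rfl
  rw [h, mk_eq_cls, cls_eq_iff]
  exact ((MvN.submatrix hX _).fromBlocks (MvN.submatrix hY _)).trans
    (isStarProjection_fromBlocks hX hY) (P.sum Q).isProj (MatProj.sum_mvN P Q)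

theorem cls_add {X Y : Matrix m m A} (hX : IsStarProjection X) (hY : IsStarProjection Y)
    (h : X * Y = 0) : cls (X + Y) (hX.add hY h) = cls X hX + cls Y hY := by
  rw [← cls_fromBlocks, cls_eq_iff]
  exact (MvN.add_of_mul_eq_zero hX hY h).symm

theorem zero_eq_cls : (0 : VMonoid A) = cls (0 : Matrix (Fin 0) (Fin 0) A) (IsStarProjection.zero _) :=
  mk_eq_cls MatProj.zero

theorem cls_eq_zero_iff {X : Matrix m m A} {hX : IsStarProjection X} : cls X hX = 0 ↔ X = 0 := by
  rw [zero_eq_cls, cls_eq_iff]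
  constructor
  · rintro ⟨v, rfl, -⟩
    ext i j
    simp [mul_apply]
  · rintro rfl
    exact ⟨0, by simp, by simp⟩

theorem cls_le_cls {X Y : Matrix m m A} (hX : IsStarProjection X) (hY : IsStarProjection Y)
    (h : Y * X = X) : Le (cls X hX) (cls Y hY) := by
  have h1 : Xᴴ = X := hX.isSelfAdjoint
  have h2 : X * X = X := hX.isIdempotentElem
  have h3 : Yᴴ = Y := hY.isSelfAdjoint
  have h' : X * Y = X := by
    rw [← h1, ← h3, ← conjTranspose_mul, h]
  have hYX := hX.sub_of_mul_eq_left hY h'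
  refine ⟨cls (Y - X) hYX, ?_⟩
  rw [← cls_add hX hYX (by rw [mul_sub, h', h2, sub_self])]
  congr 1
  abel

theorem cls_single_eq [DecidableEq m] (i : m) {p : A} (hp : IsStarProjection p) :
    cls (single i i p) (isStarProjection_single i hp) = mk (MatProj.single p hp) := by
  have h1 : star p = p := hp.isSelfAdjoint
  have h2 : p * p = p := hp.isIdempotentElem
  rw [mk_eq_cls, cls_eq_iff]
  have : MvN (single i i p) (of fun _ _ : Fin 1 => p) := by
    refine ⟨single 0 i p, ?_, ?_⟩
    · simp [h1, h2]
    · ext a b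
      simp [h1, h2, Subsingleton.elim a 0, Subsingleton.elim b 0]
  exact this

theorem cls_sum_single [DecidableEq m] {p : A} (hp : IsStarProjection p) (s : Finset m) :
    ∃ h : IsStarProjection (diagonal fun i => if i ∈ s then p else 0),
      cls (diagonal fun i => if i ∈ s then p else 0) h = s.card • mk (MatProj.single p hp) := by
  have hP : ∀ s : Finset m, IsStarProjection (diagonal fun i => if i ∈ s then p else 0) := by
    intro s
    refine isStarProjection_diagonal fun i => ?_
    split_ifs
    · exact hp
    · exact IsStarProjection.zero _
  refine ⟨hP s, ?_⟩
  induction s using Finset.induction_on with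
  | empty =>
    rw [Finset.card_empty, zero_nsmul, cls_eq_zero_iff]
    simp
  | insert a s ha ih =>
    rw [Finset.card_insert_of_notMem ha, succ_nsmul, ← ih, ← cls_single_eq a hp, ← cls_add]
    · congr 1
      ext i j
      by_cases hij : i = j
      · subst hij
        by_cases hia : i = a
        · subst hia; simp [ha]
        · simp [hia, Ne.symm hia]
      · simp only [Matrix.add_apply, diagonal_apply_ne _ hij, zero_add, single_apply]
        rw [if_neg]
        rintro ⟨rfl, rfl⟩
        exact hij rfl
    · ext i j
      simp only [diagonal_mul, single_apply, Matrix.zero_apply]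
      split_ifs with h1 h2 h2
      · exact absurd (h2.1 ▸ h1) ha
      all_goals simp

theorem cls_diagonal_const [DecidableEq m] {p : A} (hp : IsStarProjection p) :
    cls (diagonal fun _ : m => p) (isStarProjection_diagonal fun _ => hp) =
      Fintype.card m • mk (MatProj.single p hp) := by
  obtain ⟨h, h1⟩ := cls_sum_single (m := m) hp Finset.univ
  rw [← Finset.card_univ, ← h1]
  congr 1
  simp

section Le

theorem Le.refl (x : VMonoid A) : Le x x := ⟨0, add_zero x⟩

theorem Le.trans {x y z : VMonoid A} : Le x y → Le y z → Le x z := by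
  rintro ⟨a, rfl⟩ ⟨b, rfl⟩
  exact ⟨a + b, by rw [add_assoc]⟩

theorem Le.nsmul {x y : VMonoid A} (h : Le x y) (k : ℕ) : Le (k • x) (k • y) := by
  obtain ⟨a, rfl⟩ := h
  exact ⟨k • a, by rw [nsmul_add]⟩

end Le

section Map

variable {B C : Type*} [Ring B] [StarRing B] [Ring C] [StarRing C]

theorem _root_.Matrix.isStarProjection_map (φ : A →⋆ₙ+* B) {X : Matrix m m A}
    (hX : IsStarProjection X) : IsStarProjection (X.map φ) := by
  have h1 : Xᴴ = X := hX.isSelfAdjoint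
  have h2 : X * X = X := hX.isIdempotentElem
  refine ⟨?_, ?_⟩
  · change X.map φ * X.map φ = _
    rw [← Matrix.map_mul, h2]
  · change (X.map φ)ᴴ = _
    rw [← conjTranspose_map φ (fun a => map_star φ a), h1]

theorem _root_.Matrix.MvN.map (φ : A →⋆ₙ+* B) {X : Matrix m m A} {Y : Matrix n n A}
    (h : MvN X Y) : MvN (X.map φ) (Y.map φ) := by
  obtain ⟨v, rfl, rfl⟩ := h
  refine ⟨v.map φ, ?_, ?_⟩ <;>
    rw [← conjTranspose_map φ (fun a => map_star φ a), Matrix.map_mul]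

/-- The map of semigroups induced by a homomorphism of star rings. -/
def map (φ : A →⋆ₙ+* B) : VMonoid A →+ VMonoid B where
  toFun := Quotient.map (fun p => ⟨p.size, p.mat.map φ, isStarProjection_map φ p.isProj⟩)
    fun _ _ h => MvN.map φ h
  map_zero' := Quotient.sound ⟨0, by ext i; exact i.elim0, by ext i; exact i.elim0⟩
  map_add' := by
    rintro ⟨p⟩ ⟨q⟩
    refine congrArg mk ?_
    have : ((p.sum q).mat).map φ = (Matrix.fromBlocks (p.mat.map φ) 0 0 (q.mat.map φ)).submatrix
        finSumFinEquiv.symm finSumFinEquiv.symm := by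
      simp [MatProj.sum, ← submatrix_map, fromBlocks_map]
    simp only [MatProj.sum] at this ⊢
    congr 1

theorem map_cls (φ : A →⋆ₙ+* B) {X : Matrix m m A} (hX : IsStarProjection X) :
    map φ (cls X hX) = cls (X.map φ) (isStarProjection_map φ hX) := rfl

theorem map_map (ψ : B →⋆ₙ+* C) (φ : A →⋆ₙ+* B) (x : VMonoid A) :
    map ψ (map φ x) = map (ψ.comp φ) x := by
  obtain ⟨k, X, hX, rfl⟩ := exists_eq_cls x
  rfl

theorem map_id (x : VMonoid A) : map (NonUnitalStarRingHom.id A) x = x := by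
  obtain ⟨k, X, hX, rfl⟩ := exists_eq_cls x
  rfl

theorem map_zero_hom (x : VMonoid A) : map (0 : A →⋆ₙ+* B) x = 0 := by
  obtain ⟨k, X, hX, rfl⟩ := exists_eq_cls x
  rw [map_cls, cls_eq_zero_iff]
  rfl

end Map

end VMonoid

end StarRing

/-! ### V of an interval algebra is a free commutative monoid -/

namespace VMonoid

open Matrix

section Complex

/-- After diagonalisation the eigenvalues are 0 or 1; the matrix `e` selects the coordinates with
eigenvalue 1. -/
theorem exists_mvN_one_of_complex {n : Type*} [Fintype n] {X : Matrix n n ℂ}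
    (hX : IsStarProjection X) : ∃ k : ℕ, MvN X (1 : Matrix (Fin k) (Fin k) ℂ) := by
  classical
  have hh : X.IsHermitian := hX.isSelfAdjoint
  have h2 : X * X = X := hX.isIdempotentElem
  set U : Matrix n n ℂ := (hh.eigenvectorUnitary : Matrix n n ℂ) with hU
  set d : n → ℂ := fun i => (hh.eigenvalues i : ℂ) with hd
  have hUU : Uᴴ * U = 1 := Unitary.coe_star_mul_self hh.eigenvectorUnitary
  have hUU' : U * Uᴴ = 1 := Unitary.coe_mul_star_self hh.eigenvectorUnitary
  have hspec : X = U * diagonal d * Uᴴ := by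
    have := hh.spectral_theorem
    simp only [Unitary.conjStarAlgAut_apply] at this
    exact this
  have hdiag : diagonal d = Uᴴ * X * U := by
    rw [hspec]
    simp only [Matrix.mul_assoc, hUU, Matrix.mul_one]
    rw [← Matrix.mul_assoc, hUU, Matrix.one_mul]
  have hdd : ∀ i, d i * d i = d i := by
    have : diagonal d * diagonal d = diagonal d := by
      rw [hdiag]
      calc Uᴴ * X * U * (Uᴴ * X * U) = Uᴴ * X * (U * Uᴴ) * X * U := by simp only [Matrix.mul_assoc]
        _ = _ := by rw [hUU', Matrix.mul_one, Matrix.mul_assoc Uᴴ, h2]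
    intro i
    have := congrFun (congrFun this i) i
    simpa using this
  set s := {i // d i = 1}
  let e : Matrix s n ℂ := of fun a j => if (a : n) = j then 1 else 0
  have he1 : e * eᴴ = 1 := by
    ext a b
    simp only [Matrix.mul_apply, conjTranspose_apply, of_apply, e]
    rw [Finset.sum_eq_single (a : n) (fun j _ hj => by simp [hj.symm]) (by simp)]
    by_cases hab : a = b
    · subst hab; simp
    · simp [hab, Ne.symm (Subtype.coe_ne_coe.mpr hab)]
  have he2 : eᴴ * e = diagonal d := by
    ext a b
    simp only [Matrix.mul_apply, conjTranspose_apply, of_apply, e]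
    have hv : d a = 0 ∨ d a = 1 := by
      have h : d a * (d a - 1) = 0 := by rw [mul_sub, hdd, mul_one, sub_self]
      rcases mul_eq_zero.mp h with h | h
      · exact Or.inl h
      · exact Or.inr (sub_eq_zero.mp h)
    rcases hv with ha | ha
    · rw [Finset.sum_eq_zero]
      · by_cases hab : a = b
        · subst hab; simp [ha]
        · simp [hab]
      · intro c _
        have : (c : n) ≠ a := by
          rintro rfl
          rw [c.2] at ha
          exact one_ne_zero ha
        simp [this]
    · rw [Finset.sum_eq_single (⟨a, ha⟩ : s)]
      · by_cases hab : a = b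
        · subst hab; simp [ha]
        · simp [hab]
      · intro c _ hc
        have : (c : n) ≠ a := fun h => hc (Subtype.ext h)
        simp [this]
      · simp
  have hone : IsStarProjection (1 : Matrix s s ℂ) := IsStarProjection.one _
  refine ⟨Fintype.card s, MvN.trans (q := (1 : Matrix s s ℂ)) hX (IsStarProjection.one _) ?_ ?_⟩
  · refine ⟨e * Uᴴ, ?_, ?_⟩
    · rw [conjTranspose_mul, conjTranspose_conjTranspose, hspec, ← he2]
      simp only [Matrix.mul_assoc]
    · calc e * Uᴴ * (e * Uᴴ)ᴴ = e * (Uᴴ * U) * eᴴ := by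
            rw [conjTranspose_mul, conjTranspose_conjTranspose]; simp only [Matrix.mul_assoc]
        _ = 1 := by rw [hUU, Matrix.mul_one, he1]
  · have := MvN.submatrix hone (Fintype.equivFin s).symm
    simpa using this

theorem cls_one_eq_nsmul {R : Type*} [Ring R] [StarRing R] (k : ℕ) :
    cls (1 : Matrix (Fin k) (Fin k) R) (IsStarProjection.one _) =
      k • mk (MatProj.single 1 (IsStarProjection.one R)) := by
  have := cls_diagonal_const (m := Fin k) (IsStarProjection.one R)
  simpa only [diagonal_one, Fintype.card_fin] using this

/-- Projections over `ℂ` are classified by their rank. -/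
theorem nonempty_addEquiv_complex : Nonempty (VMonoid ℂ ≃+ ℕ) := by
  refine ⟨(AddEquiv.ofBijective
    (multiplesHom (VMonoid ℂ) (mk (MatProj.single 1 (IsStarProjection.one ℂ)))) ⟨?_, ?_⟩).symm⟩
  · intro a b h
    simp only [multiplesHom_apply, ← cls_one_eq_nsmul] at h
    obtain ⟨v, h1, h2⟩ := cls_eq_iff.mp h
    -- The trace of the two unit matrices recovers their sizes, so distinct multiples of the
    -- generator are distinct.
    have := trace_mul_comm vᴴ v
    rw [h1, h2, trace_one, trace_one] at this
    simpa using this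
  · intro x
    obtain ⟨k, X, hX, rfl⟩ := exists_eq_cls x
    obtain ⟨r, hr⟩ := exists_mvN_one_of_complex hX
    exact ⟨r, by rw [multiplesHom_apply, ← cls_one_eq_nsmul, cls_eq_iff]; exact hr.symm⟩

end Complex

section Interval

open unitInterval

/-- The constant functions, as a homomorphism of star rings. -/
noncomputable def constHom (T : Type*) [TopologicalSpace T] : ℂ →⋆ₙ+* C(T, ℂ) where
  toFun := ContinuousMap.const T
  map_zero' := rfl
  map_add' _ _ := rfl
  map_mul' _ _ := rfl
  map_star' _ := rfl

/-- Evaluation at a point, as a homomorphism of star rings. -/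
noncomputable def evalHom {T : Type*} [TopologicalSpace T] (t : T) : C(T, ℂ) →⋆ₙ+* ℂ where
  toFun f := f t
  map_zero' := rfl
  map_add' _ _ := rfl
  map_mul' _ _ := rfl
  map_star' _ := rfl

/-- Composition with a continuous map, as a homomorphism of star rings. -/
noncomputable def compHom {T : Type*} [TopologicalSpace T] (g : C(T, T)) : C(T, ℂ) →⋆ₙ+* C(T, ℂ) where
  toFun f := f.comp g
  map_zero' := rfl
  map_add' _ _ := rfl
  map_mul' _ _ := rfl
  map_star' _ := rfl

/-- The homotopy `s ↦ (t ↦ s t)` from a constant map to the identity of the unit interval. -/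
def scaling (s : I) : C(I, I) := ⟨fun t => s * t, by fun_prop⟩

theorem continuous_comp_scaling (f : C(I, ℂ)) : Continuous fun s : I => f.comp (scaling s) :=
  (ContinuousMap.curry ⟨fun st : I × I => f (st.1 * st.2), by fun_prop⟩).continuous

/-- Homotopy invariance: the projections X(s·) vary norm-continuously with s, and projections at
distance less than one are equivalent, so their class is locally constant on a connected space. At s
= 0 the projection is constant; at s = 1 it is X. -/
theorem map_const_eval_interval (x : VMonoid C(I, ℂ)) :
    map (constHom I) (map (evalHom (0 : I)) x) = x := by
  obtain ⟨k, X, hX, rfl⟩ := exists_eq_cls x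
  have hP : ∀ s : I, IsStarProjection (X.map (compHom (scaling s))) := fun s =>
    isStarProjection_map _ hX
  have hloc : IsLocallyConstant fun s : I => cls (X.map (compHom (scaling s))) (hP s) := by
    rw [IsLocallyConstant.iff_eventually_eq]
    intro s
    have hc : Continuous fun r : I =>
        (X.map (compHom (scaling r)) - X.map (compHom (scaling s))).l1Norm := by
      refine continuous_finsetSum _ fun i _ => continuous_finsetSum _ fun j _ => ?_
      exact ((continuous_comp_scaling (X i j)).sub continuous_const).norm
    have h0 : (X.map (compHom (scaling s)) - X.map (compHom (scaling s))).l1Norm < 1 := by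
      rw [sub_self, l1Norm_zero]; exact one_pos
    filter_upwards [hc.continuousAt.eventually_lt continuousAt_const h0] with r hr
    rw [cls_eq_iff]
    exact MvN.of_l1Norm_sub_lt_one (hP r) (hP s) hr
  have h01 := hloc.apply_eq_of_preconnectedSpace 0 1
  rw [map_cls, map_cls]
  refine Eq.trans ?_ (h01.trans ?_)
  · congr 1
    ext i j t
    change X i j 0 = X i j (0 * t)
    rw [zero_mul]
  · congr 1
    ext i j t
    change X i j (1 * t) = X i j t
    rw [one_mul]

/-- Projections over the unit interval are classified by their rank. -/
theorem nonempty_addEquiv_interval : Nonempty (VMonoid C(I, ℂ) ≃+ ℕ) := by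
  obtain ⟨e⟩ := nonempty_addEquiv_complex
  refine ⟨AddEquiv.trans ?_ e⟩
  exact
    { map (evalHom (0 : I)) with
      invFun := map (constHom I)
      left_inv := map_const_eval_interval
      right_inv := fun x => by
        obtain ⟨k, X, hX, rfl⟩ := exists_eq_cls x
        rfl }

end Interval

section Matrix

/-- A matrix of square matrices as a matrix with a product index. -/
def flatten {R l m n : Type*} (X : Matrix m n (Matrix l l R)) : Matrix (m × l) (n × l) R :=
  of fun a b => X a.1 b.1 a.2 b.2

theorem flatten_mul {R k l m n : Type*} [Ring R] [Fintype l] [Fintype n] (X : Matrix m n (Matrix l l R))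
    (Y : Matrix n k (Matrix l l R)) : flatten (X * Y) = flatten X * flatten Y := by
  ext a b
  simp [flatten, Matrix.mul_apply, Fintype.sum_prod_type, Matrix.sum_apply]

theorem flatten_conjTranspose {R l m n : Type*} [Star R] (X : Matrix m n (Matrix l l R)) : flatten Xᴴ = (flatten X)ᴴ := by
  ext a b
  simp [flatten, star_apply]

theorem flatten_injective {R l m n : Type*} :
    Function.Injective (flatten (R := R) (l := l) (m := m) (n := n)) := by
  intro X Y h
  ext a b c d
  exact congrFun (congrFun h (a, c)) (b, d)

variable {R : Type*} [Ring R] [StarRing R] {l m n : Type*} [Fintype l] [Fintype m] [Fintype n]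

theorem isStarProjection_flatten {X : Matrix m m (Matrix l l R)} (hX : IsStarProjection X) :
    IsStarProjection (flatten X) := by
  refine ⟨?_, ?_⟩
  · change _ * _ = _
    rw [← flatten_mul]
    exact congrArg _ hX.isIdempotentElem
  · change (flatten X)ᴴ = _
    rw [← flatten_conjTranspose]
    exact congrArg _ hX.isSelfAdjoint

variable [DecidableEq l]

theorem mvN_flatten_iff {X : Matrix m m (Matrix l l R)} {Y : Matrix n n (Matrix l l R)} :
    MvN (flatten X) (flatten Y) ↔ MvN X Y := by
  constructor
  · rintro ⟨v, h1, h2⟩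
    obtain ⟨w, rfl⟩ : ∃ w : Matrix n m (Matrix l l R), flatten w = v :=
      ⟨of fun a b => of fun c d => v (a, c) (b, d), rfl⟩
    rw [← flatten_conjTranspose, ← flatten_mul] at h1 h2
    exact ⟨w, flatten_injective h1, flatten_injective h2⟩
  · rintro ⟨v, rfl, rfl⟩
    exact ⟨flatten v, by rw [flatten_mul, flatten_conjTranspose], by
      rw [flatten_mul, flatten_conjTranspose]⟩

/-- Matrices over `R` and matrices over a matrix algebra over `R` have the same projections. -/
theorem nonempty_addEquiv_matrix [Nonempty l] :
    Nonempty (VMonoid (Matrix l l R) ≃+ VMonoid R) := by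
  obtain ⟨a⟩ := ‹Nonempty l›
  let f : VMonoid (Matrix l l R) →+ VMonoid R :=
    { toFun := Quotient.lift (fun p : MatProj (Matrix l l R) =>
          cls (flatten p.mat) (isStarProjection_flatten p.isProj))
        fun _ _ h => cls_eq_iff.mpr (mvN_flatten_iff.mpr h)
      map_zero' := by
        change cls _ _ = 0
        rw [cls_eq_zero_iff]
        ext i
        exact i.1.elim0
      map_add' := by
        rintro ⟨p⟩ ⟨q⟩
        change cls (flatten (p.sum q).mat) _ = cls _ _ + cls _ _
        rw [← cls_fromBlocks, cls_eq_iff]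
        have h1 := mvN_flatten_iff.mpr (MatProj.sum_mvN p q).symm
        have h2 := isStarProjection_fromBlocks p.isProj q.isProj
        have h3 := MvN.submatrix (isStarProjection_flatten h2)
          (Equiv.sumProdDistrib (Fin p.size) (Fin q.size) l).symm
        refine h1.trans (isStarProjection_flatten (p.sum q).isProj)
          (isStarProjection_fromBlocks (isStarProjection_flatten p.isProj)
            (isStarProjection_flatten q.isProj)) ?_
        convert h3 using 1
        ext (i | i) (j | j) <;> rfl }
  have hf : ∀ {m : Type} [Fintype m] (X : Matrix m m (Matrix l l R)) (hX : IsStarProjection X),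
      f (cls X hX) = cls (flatten X) (isStarProjection_flatten hX) := by
    intro m _ X hX
    refine (cls_eq_iff (hX := isStarProjection_flatten (isStarProjection_submatrix hX _))).mpr
      (mvN_flatten_iff.mpr ?_)
    exact (MvN.submatrix hX _).symm
  refine ⟨AddEquiv.ofBijective f ⟨?_, ?_⟩⟩
  · intro x y h
    obtain ⟨j, X, hX, rfl⟩ := exists_eq_cls x
    obtain ⟨k, Y, hY, rfl⟩ := exists_eq_cls y
    rw [hf, hf, cls_eq_iff, mvN_flatten_iff] at h
    exact cls_eq_iff.mpr h
  · intro y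
    obtain ⟨k, Y, hY, rfl⟩ := exists_eq_cls y
    let φ : R →⋆ₙ+* Matrix l l R :=
      { toFun := single a a
        map_zero' := by simp
        map_add' := fun _ _ => by rw [single_add]
        map_mul' := fun _ _ => by simp
        map_star' := fun _ => by rw [star_eq_conjTranspose]; simp }
    refine ⟨map φ (cls Y hY), ?_⟩
    rw [map_cls, hf, cls_eq_iff]
    have h1 : Yᴴ = Y := hY.isSelfAdjoint
    have h2 : Y * Y = Y := hY.isIdempotentElem
    -- The witness is Y preceded by the coordinate projection onto the slots with second index `a`.
    refine ⟨of fun i j => if j.2 = a then Y i j.1 else 0, ?_, ?_⟩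
    · ext ⟨i, i'⟩ ⟨j, j'⟩
      have hij : ∑ t, star (Y t i) * Y t j = Y i j := by
        conv_rhs => rw [← h2]
        simp only [Matrix.mul_apply]
        refine Finset.sum_congr rfl fun t _ => ?_
        rw [← conjTranspose_apply, h1]
      simp only [Matrix.mul_apply, conjTranspose_apply, of_apply, flatten, map_apply]
      change _ = single a a (Y i j) i' j'
      by_cases hi : i' = a <;> by_cases hj : j' = a
      · subst hi; subst hj; simpa using hij
      · simp [hj, Ne.symm hj]
      · simp [hi, Ne.symm hi]
      · simp [hi, Ne.symm hi]
    · ext i j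
      have hij : ∑ t, Y i t * star (Y j t) = Y i j := by
        conv_rhs => rw [← h2]
        simp only [Matrix.mul_apply]
        refine Finset.sum_congr rfl fun t _ => ?_
        rw [← conjTranspose_apply, h1]
      simp only [Matrix.mul_apply, conjTranspose_apply, of_apply, Fintype.sum_prod_type]
      rw [← hij]
      refine Finset.sum_congr rfl fun t _ => ?_
      rw [Finset.sum_eq_single a (fun b _ hb => by simp [hb]) (by simp)]
      simp

end Matrix

section Pi

variable {ι : Type*} [Fintype ι] {R : ι → Type*} [∀ i, Ring (R i)] [∀ i, StarRing (R i)]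

/-- A projection over a finite product is a family of projections. -/
theorem nonempty_addEquiv_pi : Nonempty (VMonoid (∀ i, R i) ≃+ ∀ i, VMonoid (R i)) := by
  classical
  obtain ⟨ev, hev⟩ : ∃ ev : ∀ i, (∀ i, R i) →⋆ₙ+* R i, ∀ i f, ev i f = f i := ⟨fun i =>
    { toFun := fun f => f i
      map_zero' := rfl
      map_add' := fun _ _ => rfl
      map_mul' := fun _ _ => rfl
      map_star' := fun _ => rfl }, fun _ _ => rfl⟩
  obtain ⟨inc, hinc⟩ : ∃ inc : ∀ i, R i →⋆ₙ+* ∀ i, R i, ∀ i x, inc i x = Pi.single i x := ⟨fun i =>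
    { toFun := Pi.single i
      map_zero' := Pi.single_zero i
      map_add' := fun _ _ => Pi.single_add i _ _
      map_mul' := fun _ _ => Pi.single_mul i _ _
      map_star' := fun x => by
        ext j
        by_cases h : j = i
        · subst h; simp
        · simp [h] }, fun _ _ => rfl⟩
  refine ⟨AddEquiv.ofBijective
    (AddMonoidHom.pi fun i => map (ev i) : VMonoid (∀ i, R i) →+ ∀ i, VMonoid (R i)) ⟨?_, ?_⟩⟩
  · intro x y h
    obtain ⟨j, X, hX, rfl⟩ := exists_eq_cls x
    obtain ⟨k, Y, hY, rfl⟩ := exists_eq_cls y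
    have h' : ∀ i, MvN (X.map (ev i)) (Y.map (ev i)) := fun i => by
      have := congrFun h i
      simpa only [AddMonoidHom.pi_apply, map_cls, cls_eq_iff] using this
    choose v hv1 hv2 using h'
    rw [cls_eq_iff]
    refine ⟨of fun a b i => v i a b, ?_, ?_⟩
    · ext a b i
      have := congrFun (congrFun (hv1 i) a) b
      simpa [Matrix.mul_apply, hev] using this
    · ext a b i
      have := congrFun (congrFun (hv2 i) a) b
      simpa [Matrix.mul_apply, hev] using this
  · intro x
    refine ⟨∑ i, map (inc i) (x i), ?_⟩
    ext j
    rw [AddMonoidHom.pi_apply, map_sum, Finset.sum_eq_single j]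
    · have : (ev j).comp (inc j) = NonUnitalStarRingHom.id (R j) := by
        ext y
        simp [hev, hinc]
      rw [map_map, this, map_id]
    · intro i _ hi
      have : (ev j).comp (inc i) = 0 := by
        ext y
        simp [hev, hinc, hi.symm]
      rw [map_map, this, map_zero_hom]
    · simp

end Pi

section Prod

variable {R S : Type*} [Ring R] [StarRing R] [Ring S] [StarRing S]

/-- A projection over a product is a pair of projections. -/
theorem nonempty_addEquiv_prod : Nonempty (VMonoid (R × S) ≃+ VMonoid R × VMonoid S) := by
  obtain ⟨p₁, hp₁⟩ : ∃ f : R × S →⋆ₙ+* R, ∀ x, f x = x.1 := ⟨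
    { toFun := Prod.fst
      map_zero' := rfl
      map_add' := fun _ _ => rfl
      map_mul' := fun _ _ => rfl
      map_star' := fun _ => rfl }, fun _ => rfl⟩
  obtain ⟨p₂, hp₂⟩ : ∃ f : R × S →⋆ₙ+* S, ∀ x, f x = x.2 := ⟨
    { toFun := Prod.snd
      map_zero' := rfl
      map_add' := fun _ _ => rfl
      map_mul' := fun _ _ => rfl
      map_star' := fun _ => rfl }, fun _ => rfl⟩
  obtain ⟨i₁, hi₁⟩ : ∃ f : R →⋆ₙ+* R × S, ∀ x, f x = (x, 0) := ⟨
    { toFun := fun r => (r, 0)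
      map_zero' := rfl
      map_add' := fun _ _ => by simp
      map_mul' := fun _ _ => by simp
      map_star' := fun _ => by ext <;> simp }, fun _ => rfl⟩
  obtain ⟨i₂, hi₂⟩ : ∃ f : S →⋆ₙ+* R × S, ∀ x, f x = (0, x) := ⟨
    { toFun := fun r => (0, r)
      map_zero' := rfl
      map_add' := fun _ _ => by simp
      map_mul' := fun _ _ => by simp
      map_star' := fun _ => by ext <;> simp }, fun _ => rfl⟩
  refine ⟨AddEquiv.ofBijective ((map p₁).prod (map p₂)) ⟨?_, ?_⟩⟩
  · intro x y h
    obtain ⟨j, X, hX, rfl⟩ := exists_eq_cls x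
    obtain ⟨k, Y, hY, rfl⟩ := exists_eq_cls y
    obtain ⟨h1, h2⟩ := Prod.ext_iff.mp h
    simp only [AddMonoidHom.prod_apply, map_cls, cls_eq_iff] at h1 h2
    obtain ⟨v, hv1, hv2⟩ := h1
    obtain ⟨w, hw1, hw2⟩ := h2
    rw [cls_eq_iff]
    refine ⟨of fun a b => (v a b, w a b), ?_, ?_⟩
    · ext a b
      · simpa [Matrix.mul_apply, hp₁, Prod.fst_sum] using congrFun (congrFun hv1 a) b
      · simpa [Matrix.mul_apply, hp₂, Prod.snd_sum] using congrFun (congrFun hw1 a) b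
    · ext a b
      · simpa [Matrix.mul_apply, hp₁, Prod.fst_sum] using congrFun (congrFun hv2 a) b
      · simpa [Matrix.mul_apply, hp₂, Prod.snd_sum] using congrFun (congrFun hw2 a) b
  · rintro ⟨x, y⟩
    refine ⟨map i₁ x + map i₂ y, ?_⟩
    have e1 : p₁.comp i₁ = NonUnitalStarRingHom.id R := by ext y; simp [hp₁, hi₁]
    have e2 : p₂.comp i₂ = NonUnitalStarRingHom.id S := by ext y; simp [hp₂, hi₂]
    have e3 : p₁.comp i₂ = 0 := by ext y; simp [hp₁, hi₂]
    have e4 : p₂.comp i₁ = 0 := by ext y; simp [hp₂, hi₁]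
    rw [AddMonoidHom.prod_apply, map_add, map_add, map_map, map_map, map_map, map_map,
      e1, e2, e3, e4, map_id, map_id, map_zero_hom, map_zero_hom, zero_add, add_zero]

end Prod

/-- The semigroup of an algebra in the class of interval algebras is simplicial. -/
theorem nonempty_addEquiv_intervalAlgebra {r s : ℕ} (k : Fin r → ℕ) (l : Fin s → ℕ)
    (hk : ∀ i, 0 < k i) (hl : ∀ j, 0 < l j) :
    Nonempty (VMonoid (((i : Fin r) → Matrix (Fin (k i)) (Fin (k i)) ℂ) ×
      ((j : Fin s) → Matrix (Fin (l j)) (Fin (l j)) C(unitInterval, ℂ))) ≃+ (Fin r ⊕ Fin s → ℕ)) := by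
  have h1 : ∀ i, Nonempty (VMonoid (Matrix (Fin (k i)) (Fin (k i)) ℂ) ≃+ ℕ) := fun i => by
    have : Nonempty (Fin (k i)) := ⟨⟨0, hk i⟩⟩
    exact ⟨(nonempty_addEquiv_matrix).some.trans nonempty_addEquiv_complex.some⟩
  have h2 : ∀ j, Nonempty (VMonoid (Matrix (Fin (l j)) (Fin (l j)) C(unitInterval, ℂ)) ≃+ ℕ) :=
    fun j => by
      have : Nonempty (Fin (l j)) := ⟨⟨0, hl j⟩⟩
      exact ⟨(nonempty_addEquiv_matrix).some.trans nonempty_addEquiv_interval.some⟩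
  refine ⟨nonempty_addEquiv_prod.some.trans ((AddEquiv.prodCongr
    (nonempty_addEquiv_pi.some.trans (AddEquiv.piCongrRight fun i => (h1 i).some))
    (nonempty_addEquiv_pi.some.trans (AddEquiv.piCongrRight fun i => (h2 i).some))).trans ?_)⟩
  exact
    { (Equiv.sumArrowEquivProdArrow (Fin r) (Fin s) ℕ).symm with
      map_add' := fun x y => by ext (i | i) <;> rfl }

end VMonoid

/-! ### Cutting projections and equivalences by an almost commuting unit -/

namespace Matrix

section Approximation

variable {A : Type*} [CStarAlgebra A] {m n : Type*} [Fintype m] [Fintype n]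

theorem l1Norm_conjTranspose_mul_self_sub_le {Y Q : Matrix n m A} {K δ : ℝ} (hδ : δ ≤ 1)
    (hQ : Q.l1Norm ≤ K) (h : (Y - Q).l1Norm ≤ δ) :
    (Yᴴ * Y - Qᴴ * Q).l1Norm ≤ (2 * K + 1) * δ := by
  have hK : 0 ≤ K := (l1Norm_nonneg _).trans hQ
  have hY : Y.l1Norm ≤ K + 1 := by
    have : Y = (Y - Q) + Q := by abel
    rw [this]
    exact (l1Norm_add_le _ _).trans (by linarith)
  have e : Yᴴ * Y - Qᴴ * Q = Yᴴ * (Y - Q) + (Y - Q)ᴴ * Q := by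
    rw [conjTranspose_sub, Matrix.mul_sub, Matrix.sub_mul]; abel
  have h1 : (Yᴴ * (Y - Q)).l1Norm ≤ (K + 1) * δ :=
    (l1Norm_mul_le _ _).trans
      (mul_le_mul (by rwa [l1Norm_conjTranspose]) h (l1Norm_nonneg _) (by linarith))
  have h2 : ((Y - Q)ᴴ * Q).l1Norm ≤ δ * K :=
    (l1Norm_mul_le _ _).trans
      (mul_le_mul (by rwa [l1Norm_conjTranspose]) hQ (l1Norm_nonneg _) ((l1Norm_nonneg _).trans h))
  rw [e]
  refine (l1Norm_add_le _ _).trans ?_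
  linarith

theorem l1Norm_mul_mul_le {k l : Type*} [Fintype k] [Fintype l] {P : Matrix k m A}
    {X : Matrix m n A} {Q : Matrix n l A} {a b c : ℝ} (hP : P.l1Norm ≤ a) (hX : X.l1Norm ≤ b)
    (hQ : Q.l1Norm ≤ c) : (P * X * Q).l1Norm ≤ a * b * c := by
  have ha := (l1Norm_nonneg _).trans hP
  have hb := (l1Norm_nonneg _).trans hX
  exact (l1Norm_mul_le _ _).trans (mul_le_mul ((l1Norm_mul_le _ _).trans
    (mul_le_mul hP hX (l1Norm_nonneg _) ha)) hQ (l1Norm_nonneg _) (mul_nonneg ha hb))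

/-- The corner of a projection by an almost commuting projection is almost idempotent. -/
theorem l1Norm_corner_mul_self_sub_le {P X : Matrix m m A} (hPP : P * P = P) (hXX : X * X = X)
    {N δ : ℝ} (hP : P.l1Norm ≤ N) (h : (X * P - P * X).l1Norm ≤ δ) :
    (P * X * P * (P * X * P) - P * X * P).l1Norm ≤ N * X.l1Norm * N * δ := by
  have e : P * X * P * (P * X * P) - P * X * P = P * X * (-(X * P - P * X)) * P := by
    simp only [mul_neg, neg_mul, mul_sub, sub_mul]
    have e1 : P * X * P * (P * X * P) = P * X * (P * X) * P := by
      simp only [mul_assoc]; rw [← mul_assoc P P, hPP]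
    have e2 : P * X * (X * P) * P = P * X * P := by
      simp only [mul_assoc]; rw [hPP, ← mul_assoc X X, hXX]
    rw [e1, e2]; abel
  rw [e]
  calc _ ≤ N * X.l1Norm * δ * N := l1Norm_mul_mul_le
          ((l1Norm_mul_le _ _).trans (mul_le_mul_of_nonneg_right hP (l1Norm_nonneg _)))
          (by rwa [l1Norm_neg]) hP
    _ = N * X.l1Norm * N * δ := by ring

/-- A matrix is close to the sum of its corners by an almost commuting projection. -/
theorem l1Norm_sub_corners_le [DecidableEq m] {P X : Matrix m m A} (hPP : P * P = P) {N δ : ℝ}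
    (hP : (1 - P).l1Norm ≤ N) (h : (X * P - P * X).l1Norm ≤ δ) :
    (X - P * X * P - (1 - P) * X * (1 - P)).l1Norm ≤ 2 * N * δ := by
  have hδ : 0 ≤ δ := (l1Norm_nonneg _).trans h
  have hN : 0 ≤ N := (l1Norm_nonneg _).trans hP
  have e : X - P * X * P - (1 - P) * X * (1 - P) =
      (1 - P) * (X * P - P * X) - (X * P - P * X) * (1 - P) := by
    have e1 : (1 - P) * (X * P - P * X) = X * P - P * X * P := by
      simp only [sub_mul, mul_sub, one_mul]
      rw [← mul_assoc P P, hPP, mul_assoc]; abel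
    have e2 : (X * P - P * X) * (1 - P) = P * X * P - P * X := by
      simp only [sub_mul, mul_sub, mul_one]
      rw [mul_assoc X P P, hPP]; abel
    rw [e1, e2]
    simp only [mul_sub, sub_mul, mul_one, one_mul]
    abel
  rw [e]
  have t1 := l1Norm_sub_le ((1 - P) * (X * P - P * X)) ((X * P - P * X) * (1 - P))
  have t2 : ((1 - P) * (X * P - P * X)).l1Norm ≤ N * δ :=
    (l1Norm_mul_le _ _).trans (mul_le_mul hP h (l1Norm_nonneg _) hN)
  have t3 : ((X * P - P * X) * (1 - P)).l1Norm ≤ δ * N :=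
    (l1Norm_mul_le _ _).trans (mul_le_mul h hP (l1Norm_nonneg _) hδ)
  linarith

variable [DecidableEq m] [DecidableEq n] {B : Type} [CStarAlgebra B] (φ : B →⋆ₙ+* A)

variable (m) in
/-- The image of the unit matrix under a homomorphism which need not be unital. -/
def unitImage : Matrix m m A := diagonal fun _ => φ 1

variable (m) in
theorem isStarProjection_unitImage : IsStarProjection (unitImage m φ) :=
  isStarProjection_diagonal fun _ => (IsStarProjection.one B).map φ

theorem unitImage_mul_mul_apply (X : Matrix m n A) (i : m) (j : n) :
    (unitImage m φ * X * unitImage n φ) i j = φ 1 * X i j * φ 1 := by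
  simp [unitImage, diagonal_mul, mul_diagonal]

theorem map_mul_unitImage {k : Type*} (E : Matrix k n B) : E.map φ * unitImage n φ = E.map φ := by
  ext i j
  simp [unitImage, mul_diagonal, ← map_mul]

theorem l1Norm_unitImage_le : (unitImage m φ).l1Norm ≤ Fintype.card m :=
  l1Norm_diagonal_le ((IsStarProjection.one B).map φ).norm_le

theorem one_sub_unitImage {m : Type*} [DecidableEq m] :
    1 - unitImage m φ = diagonal fun _ => 1 - φ 1 := by
  rw [unitImage, ← diagonal_one, diagonal_sub]

theorem l1Norm_one_sub_unitImage_le : (1 - unitImage m φ).l1Norm ≤ Fintype.card m := by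
  rw [one_sub_unitImage]
  exact l1Norm_diagonal_le ((IsStarProjection.one B).map φ).one_sub.norm_le

/-- A projection over `A` which almost commutes with the unit of a subalgebra and whose corner is
almost in the subalgebra is equivalent to the sum of a projection over the subalgebra and a
projection in the complementary corner. -/
theorem exists_cut_of_l1Norm_le {X : Matrix m m A} (hX : IsStarProjection X) {η : ℝ} (hη : 0 < η) :
    ∃ δ : ℝ, 0 < δ ∧ ∀ (B : Type) [CStarAlgebra B] (φ : B →⋆ₙ+* A), (∀ b, ‖φ b‖ = ‖b‖) →
      (X * unitImage m φ - unitImage m φ * X).l1Norm ≤ δ →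
      (∃ Y : Matrix m m B, (Y.map φ - unitImage m φ * X * unitImage m φ).l1Norm ≤ δ) →
      ∃ E : Matrix m m B, IsStarProjection E ∧
        (E.map φ - unitImage m φ * X * unitImage m φ).l1Norm ≤ η ∧
        ∃ F : Matrix m m A, IsStarProjection F ∧ (1 - unitImage m φ) * F = F ∧
          E.map φ * F = 0 ∧ MvN X (E.map φ + F) := by
  set N : ℝ := ((Fintype.card m : ℕ) : ℝ) with hN
  have hN0 : 0 ≤ N := Nat.cast_nonneg _
  set K : ℝ := N * X.l1Norm * N with hK
  have hK0 : 0 ≤ K := mul_nonneg (mul_nonneg hN0 (l1Norm_nonneg _)) hN0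
  set T : ℝ := (2 * K + 1) * (3 * K + 1) + K + (3 * K + 1) with hT
  have hT0 : 0 ≤ T := by positivity
  -- Error budget per unit of δ: the first two terms bound E - Q, the third F - h, the fourth the
  -- off-diagonal corners of X. The last ensures that H is close enough to idempotent; requiring C δ
  -- ≤ 1/8 covers both that threshold of 1/4 and the final one of 1.
  set C : ℝ := N * N * (2 * T) + (3 * K + 1) + N * N * (2 * K) + 2 * N + T with hC
  have hC0 : 0 < C := by positivity
  have hNT : 0 ≤ N * N * (2 * T) := by positivity
  have hNK : 0 ≤ N * N * (2 * K) := by positivity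
  refine ⟨min η (1 / 8) / C, by positivity, ?_⟩
  set δ := min η (1 / 8) / C with hδ
  have hδ0 : 0 < δ := by positivity
  have hCδ : C * δ = min η (1 / 8) := by rw [hδ]; field_simp
  have hCδη : C * δ ≤ η := hCδ ▸ min_le_left _ _
  have hCδ8 : C * δ ≤ 1 / 8 := hCδ ▸ min_le_right _ _
  intro B _ φ hφ h1 ⟨Y, hY⟩
  set P := unitImage m φ with hP
  have hPs : Pᴴ = P := (isStarProjection_unitImage m φ).isSelfAdjoint
  have hPP : P * P = P := (isStarProjection_unitImage m φ).isIdempotentElem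
  have hXs : Xᴴ = X := hX.isSelfAdjoint
  have hXX : X * X = X := hX.isIdempotentElem
  have hPn : P.l1Norm ≤ N := l1Norm_unitImage_le φ
  have hRn : (1 - P).l1Norm ≤ N := l1Norm_one_sub_unitImage_le φ
  set R := 1 - P with hR
  have hRp : IsStarProjection R := (isStarProjection_unitImage m φ).one_sub
  have hRs : Rᴴ = R := hRp.isSelfAdjoint
  have hRR : R * R = R := hRp.isIdempotentElem
  have hPR : P * R = 0 := by rw [hR, mul_sub, mul_one, hPP, sub_self]
  have hmapn : ∀ Z : Matrix m m B, (Z.map φ).l1Norm = Z.l1Norm := fun Z => l1Norm_map hφ Z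
  set Q := P * X * P with hQ
  have hQn : Q.l1Norm ≤ K := l1Norm_mul_mul_le hPn le_rfl hPn
  have hQs : Qᴴ = Q := by
    rw [hQ, conjTranspose_mul, conjTranspose_mul, hPs, hXs, mul_assoc]
  have hQQ : (Q * Q - Q).l1Norm ≤ K * δ := l1Norm_corner_mul_self_sub_le hPP hXX hPn h1
  -- The approximant Y of the corner Q need not be self-adjoint. The matrix Y*Y is, and it is close
  -- to Q*Q, hence to Q.
  set H : Matrix m m B := Yᴴ * Y with hH
  have hHs : Hᴴ = H := by rw [hH, conjTranspose_mul, conjTranspose_conjTranspose]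
  have hmapc : ∀ Z : Matrix m m B, (Zᴴ).map φ = (Z.map φ)ᴴ := fun Z =>
    conjTranspose_map φ (fun b => map_star φ b)
  have hHmap : H.map φ = (Y.map φ)ᴴ * Y.map φ := by rw [hH, Matrix.map_mul, hmapc]
  have h3K : (3 * K + 1) * δ ≤ C * δ := by
    refine mul_le_mul_of_nonneg_right ?_ hδ0.le
    linarith
  have hTC : T * δ ≤ C * δ := by
    refine mul_le_mul_of_nonneg_right ?_ hδ0.le
    linarith
  have hδ1 : δ ≤ 1 := by nlinarith
  have hHQ : (H.map φ - Q).l1Norm ≤ (3 * K + 1) * δ := by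
    have e : H.map φ - Q = ((Y.map φ)ᴴ * Y.map φ - Qᴴ * Q) + (Q * Q - Q) := by
      rw [hHmap, hQs]; abel
    rw [e]
    refine (l1Norm_add_le _ _).trans ?_
    have := l1Norm_conjTranspose_mul_self_sub_le hδ1 hQn hY
    linarith
  have hHH : (H * H - H).l1Norm ≤ T * δ := by
    rw [← hmapn]
    have e : (H * H - H).map φ = ((H.map φ)ᴴ * H.map φ - Qᴴ * Q) + ((Q * Q - Q) - (H.map φ - Q)) := by
      rw [← hmapc, hHs, hQs, Matrix.map_sub _ (map_sub φ), Matrix.map_mul]; abel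
    rw [e]
    have t1 := l1Norm_conjTranspose_mul_self_sub_le (by linarith) hQn hHQ
    refine (l1Norm_add_le _ _).trans ?_
    have t2 := l1Norm_sub_le (Q * Q - Q) (H.map φ - Q)
    rw [hT]
    linarith
  obtain ⟨E, _, hE, -, -, hEH⟩ := exists_isStarProjection_near hHs
    (show (H * H - H).l1Norm < 1 / 4 by linarith)
  have hEQ : (E.map φ - Q).l1Norm ≤ (N * N * (2 * T) + (3 * K + 1)) * δ := by
    have e : E.map φ - Q = (E - H).map φ + (H.map φ - Q) := by
      rw [Matrix.map_sub _ (map_sub φ)]; abel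
    rw [e]
    refine (l1Norm_add_le _ _).trans ?_
    rw [hmapn]
    have : N * N * (2 * (H * H - H).l1Norm) ≤ N * N * (2 * (T * δ)) := by gcongr
    linarith
  set h := R * X * R with hh
  have hhs : hᴴ = h := by
    rw [hh, conjTranspose_mul, conjTranspose_mul, hRs, hXs, mul_assoc]
  have h1' : (X * R - R * X).l1Norm ≤ δ := by
    have e0 : X * R - R * X = -(X * P - P * X) := by
      rw [hR]; simp only [mul_sub, sub_mul, mul_one, one_mul]; abel
    rwa [e0, l1Norm_neg]
  have hhh : (h * h - h).l1Norm ≤ K * δ := l1Norm_corner_mul_self_sub_le hRR hXX hRn h1'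
  have hKC : K * δ ≤ T * δ := by
    refine mul_le_mul_of_nonneg_right ?_ hδ0.le
    have : 0 ≤ (2 * K + 1) * (3 * K + 1) := by positivity
    linarith
  -- The factorisation F = h G puts F exactly, not just approximately, under R, whence the
  -- orthogonality to the image of E.
  obtain ⟨F, G, hF, hFG, -, hFh⟩ := exists_isStarProjection_near hhs
    (show (h * h - h).l1Norm < 1 / 4 by linarith)
  have hRF : R * F = F := by
    rw [hFG, hh]; simp only [← mul_assoc, hRR]
  have hEF : E.map φ * F = 0 := by
    rw [← map_mul_unitImage φ E, mul_assoc, ← hP, ← hRF, ← mul_assoc P, hPR, zero_mul, mul_zero]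
  refine ⟨E, hE, ?_, F, hF, hRF, hEF, ?_⟩
  · refine hEQ.trans (le_trans ?_ hCδη)
    refine mul_le_mul_of_nonneg_right ?_ hδ0.le
    linarith
  · refine MvN.of_l1Norm_sub_lt_one hX ((isStarProjection_map φ hE).add hF hEF) ?_
    have e : X - (E.map φ + F) = (X - Q - h) - (E.map φ - Q) - (F - h) := by abel
    rw [e]
    have t1 := l1Norm_sub_le ((X - Q - h) - (E.map φ - Q)) (F - h)
    have t2 := l1Norm_sub_le (X - Q - h) (E.map φ - Q)
    have t3 : (X - Q - h).l1Norm ≤ 2 * N * δ := l1Norm_sub_corners_le hPP hRn h1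
    have t6 : N * N * (2 * (h * h - h).l1Norm) ≤ N * N * (2 * (K * δ)) := by gcongr
    have t7 : (N * N * (2 * T) + (3 * K + 1) + N * N * (2 * K) + 2 * N) * δ ≤ C * δ := by
      refine mul_le_mul_of_nonneg_right ?_ hδ0.le
      linarith
    linarith

/-- With P and P' the unit images, W*W is near (P'vP)*(P'vP), which is near P v*v P = PXP because v
almost intertwines P and P', and PXP is near x. The three errors contribute 2K + 1, K and 1. Being
one-sided, the estimate is used for v and again for its adjoint. -/
theorem l1Norm_conjTranspose_mul_self_sub_cut_le {B : Type} [CStarAlgebra B] (φ : B →⋆ₙ+* A)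
    (hφ : ∀ b, ‖φ b‖ = ‖b‖) {X : Matrix m m A} {v : Matrix n m A} (hv : vᴴ * v = X)
    {W : Matrix n m B} {x : Matrix m m B} {K δ : ℝ} (hδ : δ ≤ 1)
    (hK1 : Fintype.card n * v.l1Norm * Fintype.card m ≤ K)
    (hK2 : Fintype.card m * v.l1Norm * Fintype.card m ≤ K)
    (h1 : (unitImage n φ * v - v * unitImage m φ).l1Norm ≤ δ)
    (h2 : (W.map φ - unitImage n φ * v * unitImage m φ).l1Norm ≤ δ)
    (h3 : (x.map φ - unitImage m φ * X * unitImage m φ).l1Norm ≤ δ) :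
    (Wᴴ * W - x).l1Norm ≤ (3 * K + 2) * δ := by
  have hδ0 : 0 ≤ δ := (l1Norm_nonneg _).trans h1
  set P := unitImage m φ
  set P' := unitImage n φ
  have hPs : Pᴴ = P := (isStarProjection_unitImage m φ).isSelfAdjoint
  have hPP : P * P = P := (isStarProjection_unitImage m φ).isIdempotentElem
  have hPs' : P'ᴴ = P' := (isStarProjection_unitImage n φ).isSelfAdjoint
  have hPP' : P' * P' = P' := (isStarProjection_unitImage n φ).isIdempotentElem
  have hQ : (P' * v * P).l1Norm ≤ K :=
    (l1Norm_mul_mul_le (l1Norm_unitImage_le φ) le_rfl (l1Norm_unitImage_le φ)).trans hK1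
  have t1 := l1Norm_conjTranspose_mul_self_sub_le hδ hQ h2
  have e1 : (P' * v * P)ᴴ * (P' * v * P) - P * X * P = P * vᴴ * (P' * v - v * P) * P := by
    have e2 : (P' * v * P)ᴴ * (P' * v * P) = P * vᴴ * (P' * v) * P := by
      rw [conjTranspose_mul, conjTranspose_mul, hPs, hPs']
      simp only [Matrix.mul_assoc]
      rw [← Matrix.mul_assoc P' P', hPP']
    rw [e2, ← hv, Matrix.mul_sub, Matrix.sub_mul]
    simp only [Matrix.mul_assoc, hPP]
  have t2 : ((P' * v * P)ᴴ * (P' * v * P) - P * X * P).l1Norm ≤ K * δ := by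
    rw [e1]
    calc _ ≤ Fintype.card m * v.l1Norm * δ * Fintype.card m := by
          refine l1Norm_mul_mul_le ((l1Norm_mul_le _ _).trans ?_) h1 (l1Norm_unitImage_le φ)
          rw [l1Norm_conjTranspose]
          exact mul_le_mul_of_nonneg_right (l1Norm_unitImage_le φ) (l1Norm_nonneg _)
      _ = Fintype.card m * v.l1Norm * Fintype.card m * δ := by ring
      _ ≤ K * δ := mul_le_mul_of_nonneg_right hK2 hδ0
  have e : (Wᴴ * W - x).map φ = ((W.map φ)ᴴ * W.map φ - (P' * v * P)ᴴ * (P' * v * P)) +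
      ((P' * v * P)ᴴ * (P' * v * P) - P * X * P) - (x.map φ - P * X * P) := by
    rw [Matrix.map_sub _ (map_sub φ), Matrix.map_mul, conjTranspose_map φ (fun b => map_star φ b)]
    abel
  rw [← l1Norm_map hφ, e]
  have t3 := l1Norm_sub_le (((W.map φ)ᴴ * W.map φ - (P' * v * P)ᴴ * (P' * v * P)) +
      ((P' * v * P)ᴴ * (P' * v * P) - P * X * P)) (x.map φ - P * X * P)
  have t4 := l1Norm_add_le ((W.map φ)ᴴ * W.map φ - (P' * v * P)ᴴ * (P' * v * P))
      ((P' * v * P)ᴴ * (P' * v * P) - P * X * P)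
  linarith

/-- An equivalence of projections over `A` which almost commutes with the unit of a subalgebra and
whose corner is almost in the subalgebra gives an equivalence of the cut down projections. -/
theorem exists_mvN_cut_of_l1Norm_le {X : Matrix m m A} {Z : Matrix n n A} {v : Matrix n m A}
    (hvX : vᴴ * v = X) (hvZ : v * vᴴ = Z) :
    ∃ δ : ℝ, 0 < δ ∧ ∀ (B : Type) [CStarAlgebra B] (φ : B →⋆ₙ+* A), (∀ b, ‖φ b‖ = ‖b‖) →
      (unitImage n φ * v - v * unitImage m φ).l1Norm ≤ δ →
      (∃ W : Matrix n m B, (W.map φ - unitImage n φ * v * unitImage m φ).l1Norm ≤ δ) →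
      ∀ (x : Matrix m m B) (z : Matrix n n B), IsStarProjection x → IsStarProjection z →
        (x.map φ - unitImage m φ * X * unitImage m φ).l1Norm ≤ δ →
        (z.map φ - unitImage n φ * Z * unitImage n φ).l1Norm ≤ δ → MvN x z := by
  set a : ℝ := ((Fintype.card m : ℕ) : ℝ) with ha
  set b : ℝ := ((Fintype.card n : ℕ) : ℝ) with hb
  have ha0 : 0 ≤ a := Nat.cast_nonneg _
  have hb0 : 0 ≤ b := Nat.cast_nonneg _
  have hv0 : 0 ≤ v.l1Norm := l1Norm_nonneg v
  set K : ℝ := (a + b) * v.l1Norm * (a + b) with hK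
  have hK0 : 0 ≤ K := by positivity
  have hKle : ∀ c d : ℝ, 0 ≤ c → 0 ≤ d → c ≤ a + b → d ≤ a + b → c * v.l1Norm * d ≤ K := by
    intro c d hc hd hc' hd'
    rw [hK]; gcongr
  refine ⟨1 / 8 / (3 * K + 2), by positivity, ?_⟩
  set δ := 1 / 8 / (3 * K + 2) with hδ
  have hCδ : (3 * K + 2) * δ = 1 / 8 := by rw [hδ]; field_simp
  have hδ0 : 0 < δ := by positivity
  have hδ1 : δ ≤ 1 := by nlinarith
  intro B _ φ hφ h1 ⟨W, hW⟩ x z hx hz hxX hzZ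
  refine MvN.of_l1Norm_conjTranspose_mul_self_sub_le (W := W) hx hz ?_ ?_
  · rw [← hCδ]
    exact l1Norm_conjTranspose_mul_self_sub_cut_le φ hφ hvX hδ1
      (hKle _ _ hb0 ha0 (by linarith) (by linarith)) (hKle _ _ ha0 ha0 (by linarith) (by linarith))
      h1 hW hxX
  · rw [← hCδ]
    have hPs : (unitImage m φ)ᴴ = unitImage m φ := (isStarProjection_unitImage m φ).isSelfAdjoint
    have hPs' : (unitImage n φ)ᴴ = unitImage n φ := (isStarProjection_unitImage n φ).isSelfAdjoint
    have := l1Norm_conjTranspose_mul_self_sub_cut_le φ hφ (v := vᴴ) (W := Wᴴ) (x := z) (X := Z)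
      (K := K) (δ := δ) (by rwa [conjTranspose_conjTranspose]) hδ1
      (by rw [l1Norm_conjTranspose]; exact hKle _ _ ha0 hb0 (by linarith) (by linarith))
      (by rw [l1Norm_conjTranspose]; exact hKle _ _ hb0 hb0 (by linarith) (by linarith))
      (by
        rw [← l1Norm_conjTranspose, conjTranspose_sub, conjTranspose_mul, conjTranspose_mul,
          conjTranspose_conjTranspose, hPs, hPs', ← l1Norm_neg, neg_sub]
        exact h1)
      (by
        rw [conjTranspose_map φ (fun b => map_star φ b), ← l1Norm_conjTranspose, conjTranspose_sub,
          conjTranspose_mul, conjTranspose_mul, conjTranspose_conjTranspose,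
          conjTranspose_conjTranspose, hPs, hPs', ← Matrix.mul_assoc]
        exact hW)
      hzZ
    rwa [conjTranspose_conjTranspose] at this

end Approximation

end Matrix

/-! ### Interval subalgebras as isometric images of C*-algebras -/

section IntervalSubalgebra

variable {A : Type*} [CStarAlgebra A]

/-- An interval subalgebra with unit `p` is the isometric image of a unital C*-algebra whose
semigroup is simplicial. -/
theorem IsIntervalSubalgebra.exists_hom {I : NonUnitalStarSubalgebra ℂ A}
    (hI : IsIntervalSubalgebra I) {p : A} (hpI : p ∈ I) (hp : ∀ y ∈ I, p * y = y ∧ y * p = y) :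
    ∃ (B : Type) (_ : CStarAlgebra B) (φ : B →⋆ₙ+* A), (∀ b, ‖φ b‖ = ‖b‖) ∧ φ 1 = p ∧
      (∀ y ∈ I, ∃ b, φ b = y) ∧ ∃ J : Type, Nonempty (VMonoid B ≃+ (J → ℕ)) := by
  obtain ⟨-, r, s, k, l, hk, hl, ⟨e⟩⟩ := hI
  -- The star ring is unchanged, so its semigroup is the one already computed; `CStarMatrix`
  -- supplies the C*-norm, for which an injective star homomorphism is isometric.
  let B : Type := ((i : Fin r) → CStarMatrix (Fin (k i)) (Fin (k i)) ℂ) ×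
    ((j : Fin s) → CStarMatrix (Fin (l j)) (Fin (l j)) C(unitInterval, ℂ))
  let _ : PartialOrder C(unitInterval, ℂ) := CStarAlgebra.spectralOrder _
  have _ : StarOrderedRing C(unitInterval, ℂ) := CStarAlgebra.spectralOrderedRing _
  let _ : PartialOrder ℂ := CStarAlgebra.spectralOrder _
  have _ : StarOrderedRing ℂ := CStarAlgebra.spectralOrderedRing _
  let _ : CStarAlgebra B := inferInstance
  let f : B →⋆ₙₐ[ℂ] A :=
    { toFun := fun b => (e.symm b : A)
      map_smul' := fun c b => congrArg Subtype.val (map_smul e.symm c b)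
      map_zero' := congrArg Subtype.val (map_zero e.symm)
      map_add' := fun b b' => congrArg Subtype.val (map_add e.symm b b')
      map_mul' := fun b b' => congrArg Subtype.val (map_mul e.symm b b')
      map_star' := fun b => congrArg Subtype.val (map_star e.symm b) }
  have hf : Function.Injective f := fun b b' h => e.symm.injective (Subtype.ext h)
  have hfI : ∀ y ∈ I, ∃ b, f b = y := fun y hy =>
    ⟨e ⟨y, hy⟩, congrArg Subtype.val (e.symm_apply_apply ⟨y, hy⟩)⟩
  let g : B →⋆ₙ+* A :=
    { toFun := f
      map_zero' := map_zero f
      map_add' := map_add f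
      map_mul' := map_mul f
      map_star' := map_star f }
  refine ⟨B, inferInstance, g, fun b => NonUnitalStarAlgHom.norm_map f hf b, ?_, hfI, Fin r ⊕ Fin s,
    VMonoid.nonempty_addEquiv_intervalAlgebra k l hk hl⟩
  obtain ⟨b, hb⟩ := hfI p hpI
  have h1 : f 1 = f 1 * p := ((hp (f 1) (e.symm 1).2).2).symm
  change f 1 = p
  rw [h1, ← hb, ← map_mul, one_mul]

end IntervalSubalgebra

/-! ### Cuts of finitely many classes in a TAI algebra -/

namespace VMonoid

open Matrix

variable {A : Type*} [CStarAlgebra A]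

/-- There is a map `c` from `V(A)` to a simplicial semigroup which is additive on `T`, and a
homomorphism `ψ` back to `V(A)` such that `x` and `ψ (c x)` differ by a small multiple of `u`. -/
def HasCut (N : VMonoid A → ℕ) (T : Finset (VMonoid A)) (x₀ u : VMonoid A) : Prop :=
  ∃ (J : Type) (c : VMonoid A → J → ℕ) (ψ : (J → ℕ) →+ VMonoid A),
    (∀ x ∈ T, ∀ y ∈ T, c (x + y) = c x + c y) ∧
    (∀ x ∈ T, ∃ y, x = ψ (c x) + y ∧ Le y (N x • u)) ∧ (c x₀ = 0 → x₀ = 0)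

/-- The element `a` almost commutes with the unit of the range of `φ`, and its corner is almost in
the range of `φ`. -/
def IsApprox {B : Type} [CStarAlgebra B] (φ : B →⋆ₙ+* A) (ε : ℝ) (a : A) : Prop :=
  ‖a * φ 1 - φ 1 * a‖ ≤ ε ∧ ∃ y, ‖φ 1 * a * φ 1 - φ y‖ ≤ ε

theorem IsApprox.mono {B : Type} [CStarAlgebra B] {φ : B →⋆ₙ+* A} {ε δ : ℝ} {a : A}
    (h : IsApprox φ ε a) (hεδ : ε ≤ δ) : IsApprox φ δ a :=
  ⟨h.1.trans hεδ, h.2.imp fun _ hy => hy.trans hεδ⟩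

/-- The projection `E` approximates the corner of `X` given by the unit of the range of `φ`, and
`X` is equivalent to the sum of `E` and a projection in the complementary corner. -/
def IsCut {B : Type} [CStarAlgebra B] (φ : B →⋆ₙ+* A) (η : ℝ) {k : ℕ} (X : Matrix (Fin k) (Fin k) A)
    (E : Matrix (Fin k) (Fin k) B) : Prop :=
  IsStarProjection E ∧ (E.map φ - unitImage _ φ * X * unitImage _ φ).l1Norm ≤ η ∧
    ∃ F : Matrix (Fin k) (Fin k) A, IsStarProjection F ∧ (1 - unitImage _ φ) * F = F ∧
      E.map φ * F = 0 ∧ MvN X (E.map φ + F)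

section Entries

variable {m n : Type} [Fintype m] [Fintype n] [DecidableEq m] [DecidableEq n] {B : Type}
  [CStarAlgebra B] {φ : B →⋆ₙ+* A} {ε : ℝ} {Y : Matrix n m A}

theorem IsApprox.l1Norm_commutator_le (hY : ∀ i j, IsApprox φ ε (Y i j)) :
    (unitImage n φ * Y - Y * unitImage m φ).l1Norm ≤ Fintype.card n * Fintype.card m * ε := by
  refine l1Norm_le_of_norm_entry_le fun i j => ?_
  have := (hY i j).1
  rw [norm_sub_rev] at this
  simpa [unitImage, diagonal_mul, mul_diagonal] using this

theorem IsApprox.exists_l1Norm_le (hY : ∀ i j, IsApprox φ ε (Y i j)) : ∃ W : Matrix n m B,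
    (W.map φ - unitImage n φ * Y * unitImage m φ).l1Norm ≤
      Fintype.card n * Fintype.card m * ε := by
  choose w hw using fun i j => (hY i j).2
  refine ⟨of w, l1Norm_le_of_norm_entry_le fun i j => ?_⟩
  have := hw i j
  rw [norm_sub_rev] at this
  rw [Matrix.sub_apply, unitImage_mul_mul_apply]
  exact this

theorem exists_pos_mul_le (C : ℝ) {d : ℝ} (hd : 0 < d) : ∃ t : ℝ, 0 < t ∧ t ≤ d ∧ C * t ≤ d := by
  refine ⟨d / (|C| + 1), by positivity, ?_, ?_⟩
  · exact div_le_self hd.le (by linarith [abs_nonneg C])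
  · rw [mul_div_assoc', div_le_iff₀ (by positivity), mul_comm]
    exact mul_le_mul_of_nonneg_left ((le_abs_self C).trans (by linarith)) hd.le

end Entries

theorem exists_isCut {k : ℕ} {X : Matrix (Fin k) (Fin k) A} (hX : IsStarProjection X) {η : ℝ}
    (hη : 0 < η) : ∃ ε : ℝ, 0 < ε ∧ ∀ (B : Type) [CStarAlgebra B] (φ : B →⋆ₙ+* A),
      (∀ b, ‖φ b‖ = ‖b‖) → (∀ i j, IsApprox φ ε (X i j)) → ∃ E, IsCut φ η X E := by
  obtain ⟨δ, hδ0, hδ⟩ := exists_cut_of_l1Norm_le hX hη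
  obtain ⟨ε, hε0, -, hε⟩ := exists_pos_mul_le
    (Fintype.card (Fin k) * Fintype.card (Fin k)) hδ0
  refine ⟨ε, hε0, fun B _ φ hφ h => hδ B φ hφ ?_ ?_⟩
  · rw [← l1Norm_neg, neg_sub]
    exact (IsApprox.l1Norm_commutator_le h).trans hε
  · obtain ⟨W, hW⟩ := IsApprox.exists_l1Norm_le h
    exact ⟨W, hW.trans hε⟩

/-- Source of the additivity of the cut map: the relation [X] + [Y] = [Z] is implemented by v, and
it survives once the entries of v are approximated too. It holds for every choice of cuts, so the
cut of each class may be chosen independently. -/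
theorem exists_mvN_isCut {k l r : ℕ} {X : Matrix (Fin k) (Fin k) A} {Y : Matrix (Fin l) (Fin l) A}
    {Z : Matrix (Fin r) (Fin r) A} {v : Matrix (Fin r) (Fin k ⊕ Fin l) A}
    (hv1 : vᴴ * v = Matrix.fromBlocks X 0 0 Y) (hv2 : v * vᴴ = Z) :
    ∃ ε : ℝ, 0 < ε ∧ ∀ (B : Type) [CStarAlgebra B] (φ : B →⋆ₙ+* A) (η : ℝ),
      (∀ b, ‖φ b‖ = ‖b‖) → (∀ i j, IsApprox φ ε (v i j)) → η ≤ ε →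
      ∀ E₁ E₂ E, IsCut φ η X E₁ → IsCut φ η Y E₂ → IsCut φ η Z E →
        MvN (Matrix.fromBlocks E₁ 0 0 E₂) E := by
  obtain ⟨δ, hδ0, hδ⟩ := exists_mvN_cut_of_l1Norm_le hv1 hv2
  obtain ⟨ε₁, hε0, hεδ, hε⟩ := exists_pos_mul_le
    (Fintype.card (Fin r) * Fintype.card (Fin k ⊕ Fin l)) hδ0
  -- The block diagonal sum of two cuts carries both errors η, hence half of δ.
  refine ⟨min ε₁ (δ / 2), by positivity, ?_⟩
  intro B _ φ η hφ h hη E₁ E₂ E hE₁ hE₂ hE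
  replace h : ∀ i j, IsApprox φ ε₁ (v i j) := fun i j => (h i j).mono (min_le_left _ _)
  have hη2 : η ≤ δ / 2 := hη.trans (min_le_right _ _)
  refine hδ B φ hφ ((IsApprox.l1Norm_commutator_le h).trans hε) ?_ _ _
    (isStarProjection_fromBlocks hE₁.1 hE₂.1) hE.1 ?_ ?_
  · obtain ⟨W, hW⟩ := IsApprox.exists_l1Norm_le h
    exact ⟨W, hW.trans hε⟩
  · have h4 : (Matrix.fromBlocks E₁ 0 0 E₂).map φ - unitImage _ φ *
        Matrix.fromBlocks X 0 0 Y * unitImage _ φ = Matrix.fromBlocks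
          (E₁.map φ - unitImage _ φ * X * unitImage _ φ) 0 0
          (E₂.map φ - unitImage _ φ * Y * unitImage _ φ) := by
      ext (i | i) (j | j) <;> simp [unitImage_mul_mul_apply]
    rw [h4, l1Norm_fromBlocks, l1Norm_zero, l1Norm_zero]
    have := hE₁.2.1
    have := hE₂.2.1
    linarith
  · have := hE.2.1
    linarith

/-- A zero cut makes all compressed entries small, which conflicts with the lower bound on ‖pbp‖
when b is a nonzero entry. This is how a cut detects a prescribed nonzero class. -/
theorem norm_entry_le_of_isCut_zero {B : Type} [CStarAlgebra B] {φ : B →⋆ₙ+* A} {η : ℝ} {k : ℕ}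
    {X : Matrix (Fin k) (Fin k) A} (h : IsCut φ η X 0) (i j : Fin k) : ‖φ 1 * X i j * φ 1‖ ≤ η := by
  have h2 := (norm_entry_le_l1Norm _ i j).trans h.2.1
  rwa [Matrix.sub_apply, unitImage_mul_mul_apply, Matrix.map_apply, Matrix.zero_apply, map_zero,
    zero_sub, norm_neg] at h2

/-- The remainder lies under the diagonal projection with k entries 1 - φ(1). The size of the
representing matrix therefore bounds the multiple of u in `HasCut`. -/
theorem IsCut.exists_eq_add {B : Type} [CStarAlgebra B] {φ : B →⋆ₙ+* A} {η : ℝ} {k : ℕ}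
    {X : Matrix (Fin k) (Fin k) A} (hX : IsStarProjection X) {E : Matrix (Fin k) (Fin k) B}
    (h : IsCut φ η X E) :
    ∃ y, cls X hX = map φ (cls E h.1) + y ∧ Le y (k • mk (MatProj.single (1 - φ 1)
      ((IsStarProjection.one B).map φ).one_sub)) := by
  obtain ⟨G, hG, h2, h3, h4⟩ := h.2.2
  refine ⟨cls G hG, ?_, ?_⟩
  · rw [map_cls, ← cls_add _ _ h3]
    exact cls_eq_iff.mpr h4
  · have h5 := cls_diagonal_const (m := Fin k) ((IsStarProjection.one B).map φ).one_sub
    rw [Fintype.card_fin] at h5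
    rw [← h5]
    exact cls_le_cls hG _ (by rw [← one_sub_unitImage]; exact h2)

theorem exists_pos_forall_le {α : Type*} (S : Finset α) {f : α → ℝ} (hf : ∀ x, 0 < f x) :
    ∃ ε : ℝ, 0 < ε ∧ ∀ x ∈ S, ε ≤ f x := by
  classical
  induction S using Finset.induction_on with
  | empty => exact ⟨1, one_pos, by simp⟩
  | insert a S _ ih =>
    obtain ⟨ε, hε, h⟩ := ih
    refine ⟨min ε (f a), lt_min hε (hf a), fun x hx => ?_⟩
    rcases Finset.mem_insert.mp hx with rfl | hx
    · exact min_le_right _ _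
    · exact (min_le_left _ _).trans (h x hx)

/-- Finitely many entries of matrices over `A` control whether a subalgebra gives a cut. -/
theorem exists_hasCut_of_hom [Nontrivial A] {N : VMonoid A → ℕ}
    (hN : ∀ x, ∃ (X : Matrix (Fin (N x)) (Fin (N x)) A) (hX : IsStarProjection X), x = cls X hX)
    (T : Finset (VMonoid A)) (x₀ : VMonoid A) :
    ∃ (ε : ℝ) (F : Finset A) (b : A), 0 < ε ∧ b ∈ F ∧ b ≠ 0 ∧
      ∀ (B : Type) [CStarAlgebra B] (φ : B →⋆ₙ+* A) (J : Type), (∀ b, ‖φ b‖ = ‖b‖) →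
        Nonempty (VMonoid B ≃+ (J → ℕ)) → (∀ x ∈ F, IsApprox φ ε x) →
        ‖b‖ - ε ≤ ‖φ 1 * b * φ 1‖ →
        HasCut N T x₀ (mk (MatProj.single (1 - φ 1) ((IsStarProjection.one B).map φ).one_sub)) := by
  classical
  choose X hX hcls using hN
  have hv : ∀ x y, MvN (Matrix.fromBlocks (X x) 0 0 (X y)) (X (x + y)) := by
    intro x y
    rw [← cls_eq_iff (hX := isStarProjection_fromBlocks (hX x) (hX y)) (hY := hX _),
      cls_fromBlocks (hX x) (hX y), ← hcls, ← hcls, ← hcls]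
  choose v hv1 hv2 using hv
  choose δ hδ0 hδ using fun x y => exists_mvN_isCut (hv1 x y) (hv2 x y)
  obtain ⟨b, hb0, hb⟩ : ∃ b : A, b ≠ 0 ∧ (X x₀ ≠ 0 → ∃ i j, X x₀ i j = b) := by
    by_cases h : X x₀ = 0
    · exact ⟨1, one_ne_zero, fun h' => absurd h h'⟩
    · obtain ⟨i, j, hij⟩ : ∃ i j, X x₀ i j ≠ 0 := by
        by_contra! hc
        exact h (by ext i j; exact hc i j)
      exact ⟨_, hij, fun _ => ⟨i, j, rfl⟩⟩
  have hbn := norm_pos_iff.mpr hb0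
  obtain ⟨ε₁, hε₁0, hε₁⟩ := exists_pos_forall_le (T ×ˢ T) (f := fun z => δ z.1 z.2)
    fun z => hδ0 z.1 z.2
  -- If the cut of `x₀` were zero, then ‖b‖ - η ≤ ‖pbp‖ ≤ η, so ‖b‖ ≤ ‖b‖/2, which is impossible.
  have hη0 : 0 < min ε₁ (‖b‖ / 4) := by positivity
  set η := min ε₁ (‖b‖ / 4)
  choose δ' hδ'0 hδ' using fun x => exists_isCut (hX x) hη0
  obtain ⟨S, hxS, hTS, hTTS⟩ : ∃ S : Finset (VMonoid A), x₀ ∈ S ∧ (∀ x ∈ T, x ∈ S) ∧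
      ∀ x ∈ T, ∀ y ∈ T, x + y ∈ S :=
    ⟨insert x₀ (T ∪ (T ×ˢ T).image fun z => z.1 + z.2), Finset.mem_insert_self _ _,
      fun x hx => Finset.mem_insert_of_mem (Finset.mem_union_left _ hx),
      fun x hx y hy => Finset.mem_insert_of_mem (Finset.mem_union_right _
        (Finset.mem_image.mpr ⟨(x, y), Finset.mk_mem_product hx hy, rfl⟩))⟩
  obtain ⟨ε₂, hε₂0, hε₂⟩ := exists_pos_forall_le S hδ'0
  obtain ⟨F, hbF, hFX, hFv⟩ : ∃ F : Finset A, b ∈ F ∧ (∀ x ∈ S, ∀ i j, X x i j ∈ F) ∧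
      ∀ x ∈ T, ∀ y ∈ T, ∀ i j, v x y i j ∈ F := by
    refine ⟨insert b ((S.biUnion fun x => Finset.univ.image fun ij : _ × _ => X x ij.1 ij.2) ∪
      (T ×ˢ T).biUnion fun z => Finset.univ.image fun ij : _ × _ => v z.1 z.2 ij.1 ij.2),
      Finset.mem_insert_self _ _, fun x hx i j => ?_, fun x hx y hy i j => ?_⟩
    · refine Finset.mem_insert_of_mem (Finset.mem_union_left _ (Finset.mem_biUnion.mpr ⟨x, hx, ?_⟩))
      exact Finset.mem_image.mpr ⟨(i, j), Finset.mem_univ _, rfl⟩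
    · refine Finset.mem_insert_of_mem (Finset.mem_union_right _ (Finset.mem_biUnion.mpr
        ⟨(x, y), Finset.mk_mem_product hx hy, ?_⟩))
      exact Finset.mem_image.mpr ⟨(i, j), Finset.mem_univ _, rfl⟩
  refine ⟨min η ε₂, F, b, by positivity, hbF, hb0, ?_⟩
  intro B _ φ J hφ ⟨e⟩ happ hbφ
  have hgood : ∀ x ∈ S, ∃ E, IsCut φ η (X x) E := fun x hx => hδ' x B φ hφ fun i j =>
    (happ _ (hFX x hx i j)).mono ((min_le_right _ _).trans (hε₂ x hx))
  -- Only values on S matter: it contains `x₀`, T and all sums of two elements of T. Where no cut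
  -- exists the default value is 0.
  obtain ⟨c, hc⟩ : ∃ c : VMonoid A → J → ℕ, ∀ x ∈ S, ∃ (E : Matrix (Fin (N x)) (Fin (N x)) B)
      (hE : IsCut φ η (X x) E), c x = e (cls E hE.1) :=
    ⟨fun x => if h : ∃ E, IsCut φ η (X x) E then e (cls h.choose h.choose_spec.1) else 0,
      fun x hx => ⟨(hgood x hx).choose, (hgood x hx).choose_spec, dif_pos (hgood x hx)⟩⟩
  refine ⟨J, c, (map φ).comp e.symm.toAddMonoidHom, ?_, ?_, ?_⟩
  · intro x hx y hy
    obtain ⟨E₁, hE₁, h1⟩ := hc x (hTS x hx)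
    obtain ⟨E₂, hE₂, h2⟩ := hc y (hTS y hy)
    obtain ⟨E, hE, h3⟩ := hc (x + y) (hTTS x hx y hy)
    have hxy := hε₁ _ (Finset.mk_mem_product hx hy)
    rw [h1, h2, h3, ← map_add, ← cls_fromBlocks]
    refine congrArg e (cls_eq_iff.mpr (MvN.symm ?_))
    exact hδ x y B φ η hφ (fun i j => (happ _ (hFv x hx y hy i j)).mono
      ((min_le_left _ _).trans ((min_le_left _ _).trans hxy))) ((min_le_left _ _).trans hxy) _ _ _
      hE₁ hE₂ hE
  · intro x hx
    obtain ⟨E, hE, h1⟩ := hc x (hTS x hx)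
    obtain ⟨y, h2, h3⟩ := hE.exists_eq_add (hX x)
    refine ⟨y, ?_, h3⟩
    rw [h1]
    refine (hcls x).trans (h2.trans ?_)
    change _ = map φ (e.symm (e _)) + _
    rw [e.symm_apply_apply]
  · intro h0
    obtain ⟨E, hE, h1⟩ := hc x₀ hxS
    rw [h1, map_eq_zero_iff e e.injective, cls_eq_zero_iff] at h0
    subst h0
    by_contra hx0
    have hX0 : X x₀ ≠ 0 := fun h => hx0 (by rw [hcls x₀]; exact cls_eq_zero_iff.mpr h)
    obtain ⟨i, j, rfl⟩ := hb hX0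
    have h2 := norm_entry_le_of_isCut_zero hE i j
    have h3 : η ≤ ‖X x₀ i j‖ / 4 := min_le_right _ _
    have h4 : min η ε₂ ≤ η := min_le_left _ _
    linarith

/-- In a TAI algebra, there are cuts with small complement. -/
theorem _root_.IsTAI.exists_hasCut [Nontrivial A] [PartialOrder A] [StarOrderedRing A]
    (hA : IsTAI A) {N : VMonoid A → ℕ}
    (hN : ∀ x, ∃ (X : Matrix (Fin (N x)) (Fin (N x)) A) (hX : IsStarProjection X), x = cls X hX)
    (T : Finset (VMonoid A)) (x₀ : VMonoid A) {n : ℕ} (hn : 0 < n) {a : A} (ha : 0 ≤ a)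
    (hfull : IsFullElement a) :
    ∃ (p : A) (hp : IsStarProjection p),
      HasCut N T x₀ (mk (MatProj.single (1 - p) hp.one_sub)) ∧
      Le (n • mk (MatProj.single (1 - p) hp.one_sub)) (mk (MatProj.single p hp)) ∧
      ProjSubequiv (1 - p) a := by
  obtain ⟨ε, F, b, hε, hbF, hb0, h⟩ := exists_hasCut_of_hom hN T x₀
  obtain ⟨p, hp, I, -, hI, ⟨hpI, hpy⟩, h1, h2, h3, h4, h5⟩ := hA F b hbF hb0 ε hε n hn a ha hfull
  obtain ⟨B, _, φ, hφ, rfl, hφI, J, hJ⟩ := hI.exists_hom hpI hpy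
  refine ⟨φ 1, hp, h B φ J hφ hJ (fun x hx => ⟨(h1 x hx).le, ?_⟩) h3, h4, h5⟩
  obtain ⟨y, hyI, hy⟩ := h2 x hx
  obtain ⟨b', rfl⟩ := hφI y hyI
  exact ⟨b', hy.le⟩

end VMonoid

/-! ### Consequences of simplicity: comparison of nonzero projections -/

section Simple

variable {A : Type*} [CStarAlgebra A]

/-- The closure of a two-sided ideal. -/
def TwoSidedIdeal.topologicalClosure (J : TwoSidedIdeal A) : TwoSidedIdeal A :=
  TwoSidedIdeal.mk' (closure (J : Set A)) (subset_closure J.zero_mem)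
    (fun {_ _} hx hy => map_mem_closure₂ continuous_add hx hy fun _ ha _ hb => J.add_mem ha hb)
    (fun {_} hx => map_mem_closure continuous_neg hx fun _ ha => J.neg_mem ha)
    (fun {x _} hy => map_mem_closure (continuous_const_mul x) hy fun _ ha => J.mul_mem_left x _ ha)
    (by
      intro x y hx
      exact map_mem_closure (f := fun z => z * y) (continuous_mul_const y) hx
        fun z hz => J.mul_mem_right z y hz)

theorem TwoSidedIdeal.coe_topologicalClosure (J : TwoSidedIdeal A) :
    (J.topologicalClosure : Set A) = closure (J : Set A) :=
  Set.ext fun x => TwoSidedIdeal.mem_mk' _ _ _ _ _ _ x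

theorem IsSimpleCStarAlgebra.isFullElement (hA : IsSimpleCStarAlgebra A) {a : A} (ha : a ≠ 0) :
    IsFullElement a := by
  have h := hA.2 (TwoSidedIdeal.span {a}).topologicalClosure
    (by rw [TwoSidedIdeal.coe_topologicalClosure]; exact isClosed_closure)
  rw [IsFullElement, ← TwoSidedIdeal.coe_topologicalClosure]
  rcases h with h | h
  · exfalso
    have h1 : a ∈ ((TwoSidedIdeal.span {a}).topologicalClosure : Set A) := by
      rw [TwoSidedIdeal.coe_topologicalClosure]
      exact subset_closure (TwoSidedIdeal.subset_span rfl)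
    rw [h] at h1
    exact ha h1
  · rw [h]; rfl

/-- Simple algebras are prime: the x with xAb = 0 form a closed two-sided ideal, which does not
contain 1 when b ≠ 0. -/
theorem IsSimpleCStarAlgebra.exists_mul_mul_ne_zero (hA : IsSimpleCStarAlgebra A) {a b : A}
    (ha : a ≠ 0) (hb : b ≠ 0) : ∃ g, a * g * b ≠ 0 := by
  by_contra! hg
  let J : TwoSidedIdeal A := TwoSidedIdeal.mk' {x | ∀ g, x * g * b = 0} (by simp)
    (fun {x y} hx hy g => by rw [add_mul, add_mul, hx g, hy g, add_zero])
    (fun {x} hx g => by rw [neg_mul, neg_mul, hx g, neg_zero])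
    (fun {x y} hy g => by rw [mul_assoc x, mul_assoc x, hy g, mul_zero])
    (fun {x y} hx g => by rw [mul_assoc x, hx (y * g)])
  have hJ : ∀ x, x ∈ J ↔ ∀ g, x * g * b = 0 := fun x => TwoSidedIdeal.mem_mk' _ _ _ _ _ _ x
  have hclosed : IsClosed (J : Set A) := by
    have : (J : Set A) = ⋂ g, {x | x * g * b = 0} := by
      ext x
      simpa using hJ x
    rw [this]
    exact isClosed_iInter fun g => isClosed_eq (by fun_prop) continuous_const
  rcases hA.2 J hclosed with h | h
  · have : a ∈ J := (hJ a).mpr hg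
    rw [h] at this
    exact ha this
  · have : (1 : A) ∈ J := by rw [h]; trivial
    have := (hJ 1).mp this 1
    rw [one_mul, one_mul] at this
    exact hb this

theorem exists_sum_of_mem_span {r x : A} (hx : x ∈ TwoSidedIdeal.span {r}) :
    ∃ (K : ℕ) (s t : Fin K → A), x = ∑ k, s k * r * t k := by
  rw [TwoSidedIdeal.mem_span_iff_mem_addSubgroup_closure] at hx
  induction hx using AddSubgroup.closure_induction with
  | mem x hx =>
    obtain ⟨_, ⟨a, -, _, rfl, rfl⟩, b, -, rfl⟩ := hx
    exact ⟨1, fun _ => a, fun _ => b, by simp⟩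
  | zero => exact ⟨0, Fin.elim0, Fin.elim0, by simp⟩
  | add x y _ _ hx hy =>
    obtain ⟨K, s, t, rfl⟩ := hx
    obtain ⟨L, s', t', rfl⟩ := hy
    exact ⟨K + L, Fin.append s s', Fin.append t t', by simp [Fin.sum_univ_add]⟩
  | neg x _ hx =>
    obtain ⟨K, s, t, rfl⟩ := hx
    exact ⟨K, fun k => -s k, t, by simp⟩

/-- A dense ideal meets the open unit ball around 1, so it contains an invertible element; no
closure is needed to reach 1. -/
theorem IsSimpleCStarAlgebra.exists_one_eq_sum (hA : IsSimpleCStarAlgebra A) {r : A} (hr : r ≠ 0) :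
    ∃ (K : ℕ) (s t : Fin K → A), 1 = ∑ k, s k * r * t k := by
  have h1 : (1 : A) ∈ closure (TwoSidedIdeal.span {r} : Set A) := by
    rw [hA.isFullElement hr]; trivial
  obtain ⟨y, hy, h2⟩ := Metric.mem_closure_iff.mp h1 1 one_pos
  rw [dist_eq_norm] at h2
  have h3 : IsUnit y := by
    have := isUnit_one_sub_of_norm_lt_one h2
    rwa [sub_sub_cancel] at this
  obtain ⟨u, rfl⟩ := h3
  refine exists_sum_of_mem_span ?_
  rw [← u.mul_inv]
  exact TwoSidedIdeal.mul_mem_right _ _ _ hy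

end Simple

namespace VMonoid

open Matrix

variable {A : Type*} [CStarAlgebra A]

theorem _root_.Matrix.l1Norm_single {m n : Type*} [Fintype m] [Fintype n] [DecidableEq m]
    [DecidableEq n] (i : m) (j : n) (a : A) : (single i j a).l1Norm = ‖a‖ := by
  rw [l1Norm, Finset.sum_eq_single i, Finset.sum_eq_single j]
  · simp
  · intro b _ hb; simp [hb.symm]
  · simp
  · intro b _ hb; simp [hb.symm]
  · simp

theorem cls_le_cls_of_mul_eq {m n : Type*} [Fintype m] [Fintype n] {q : Matrix m m A}
    {D : Matrix n n A} {W : Matrix n m A} (hq : IsStarProjection q) (hD : IsStarProjection D)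
    (h1 : Wᴴ * W = q) (h2 : D * W = W) : Le (cls q hq) (cls D hD) := by
  have hqs : qᴴ = q := hq.isSelfAdjoint
  have hqq : q * q = q := hq.isIdempotentElem
  set V := W * q with hV
  have hVV : Vᴴ * V = q := by
    rw [hV, conjTranspose_mul, hqs]
    calc q * Wᴴ * (W * q) = q * (Wᴴ * W) * q := by simp only [Matrix.mul_assoc]
      _ = q := by rw [h1, hqq, hqq]
  have hVq : V * q = V := by rw [hV, Matrix.mul_assoc, hqq]
  have hE : IsStarProjection (V * Vᴴ) := by
    refine ⟨?_, ?_⟩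
    · change _ * _ = _
      calc V * Vᴴ * (V * Vᴴ) = V * (Vᴴ * V) * Vᴴ := by simp only [Matrix.mul_assoc]
        _ = V * Vᴴ := by rw [hVV, hVq]
    · change (V * Vᴴ)ᴴ = _
      rw [conjTranspose_mul, conjTranspose_conjTranspose]
  rw [(cls_eq_iff (hY := hE)).mpr (show MvN q (V * Vᴴ) from ⟨V, hVV, rfl⟩)]
  refine cls_le_cls hE hD ?_
  rw [← Matrix.mul_assoc, hV, ← Matrix.mul_assoc, h2]

/-- In a simple algebra, the unit is dominated by a multiple of any nonzero projection. -/
theorem exists_one_le_nsmul (hA : IsSimpleCStarAlgebra A) {r : A} (hr : IsStarProjection r)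
    (hr0 : r ≠ 0) : ∃ K : ℕ, Le (mk (MatProj.single (1 : A) (IsStarProjection.one A)))
      (K • mk (MatProj.single r hr)) := by
  have _ := hA.1
  obtain ⟨K, s, t, hst⟩ := hA.exists_one_eq_sum hr0
  have hrr : r * r = r := hr.isIdempotentElem
  have hK : 0 < K := by
    rcases Nat.eq_zero_or_pos K with rfl | h
    · simp at hst
    · exact h
  let i₀ : Fin K := ⟨0, hK⟩
  -- The sum for 1 is the product of a row (s k) and a column (r t k), padded to square matrices.
  -- The column has range under diag(r, ..., r), so its polar decomposition embeds the unit there.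
  let S : Matrix (Fin K) (Fin K) A := of fun i k => if i = i₀ then s k else 0
  let T : Matrix (Fin K) (Fin K) A := of fun k j => if j = i₀ then r * t k else 0
  have hST : S * T = single i₀ i₀ 1 := by
    ext i j
    simp only [S, T, Matrix.mul_apply, of_apply, single_apply]
    by_cases hi : i = i₀
    · by_cases hj : j = i₀
      · simp [hi, hj, hst, mul_assoc]
      · simp [hj, Ne.symm hj]
    · simp [hi, Ne.symm hi]
  have hq := isStarProjection_single i₀ (IsStarProjection.one A)
  obtain ⟨z, hz⟩ := exists_mul_of_l1Norm_sub_lt (s := S) (t := T) hq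
    (by rw [hST, sub_self, l1Norm_zero]; exact one_pos)
  refine ⟨K, ?_⟩
  have h1 := cls_diagonal_const (m := Fin K) hr
  rw [Fintype.card_fin] at h1
  rw [← h1, ← cls_single_eq i₀]
  refine cls_le_cls_of_mul_eq hq _ hz ?_
  rw [← Matrix.mul_assoc]
  congr 1
  ext k j
  simp only [diagonal_mul, T, of_apply, mul_ite, mul_zero, ← mul_assoc, hrr]

/-- A projection in the hereditary subalgebra generated by a multiple of an entry of the
projection `X` is dominated by `X`. -/
theorem mk_single_le_cls_of_mem_closure {n : Type*} [Fintype n] {X : Matrix n n A}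
    (hX : IsStarProjection X) (i j : n) {q a c d : A} (hq : IsStarProjection q)
    (ha : a = d * X i j * c) (h : q ∈ closure (Set.range fun x : A => a * x * a)) :
    Le (mk (MatProj.single q hq)) (cls X hX) := by
  classical
  obtain ⟨_, ⟨x, rfl⟩, hx⟩ := Metric.mem_closure_iff.mp h 1 one_pos
  rw [dist_eq_norm] at hx
  have hXX : X * X = X := hX.isIdempotentElem
  -- The approximant a x a of q factors through X, since a does.
  have h1 : single i i d * (X * single j i (c * (x * a))) = single i i (a * x * a) := by
    rw [← Matrix.mul_assoc, single_mul_mul_single, ← mul_assoc (d * X i j), ← ha, ← mul_assoc]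
  obtain ⟨z, hz⟩ := exists_mul_of_l1Norm_sub_lt (s := single i i d)
    (t := X * single j i (c * (x * a))) (isStarProjection_single i hq) (by
      have h2 : single i i q - single i i (a * x * a) = single i i (q - a * x * a) :=
        (map_sub (singleAddMonoidHom i i) q (a * x * a)).symm
      rwa [h1, h2, l1Norm_single])
  rw [← cls_single_eq i]
  refine cls_le_cls_of_mul_eq _ hX hz ?_
  rw [← Matrix.mul_assoc, ← Matrix.mul_assoc, hXX]

theorem mk_single_eq_of_projEquiv {p q : A} {hp : IsStarProjection p} {hq : IsStarProjection q}
    (h : ProjEquiv p q) : mk (MatProj.single p hp) = mk (MatProj.single q hq) := by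
  obtain ⟨v, h1, h2⟩ := h
  refine Quotient.sound ⟨of fun _ _ : Fin 1 => v, ?_, ?_⟩
  · ext i j
    change ∑ _ : Fin 1, star v * v = p
    simpa using h1
  · ext i j
    change ∑ _ : Fin 1, v * star v = q
    simpa using h2

theorem mk_single_eq_zero_iff {p : A} {hp : IsStarProjection p} :
    mk (MatProj.single p hp) = 0 ↔ p = 0 := by
  rw [← cls_single_eq (0 : Fin 1), cls_eq_zero_iff]
  exact ⟨fun h => by simpa using congrFun (congrFun h 0) 0, fun h => by rw [h, single_zero]⟩

theorem mk_single_le_of_projSubequiv {p a : A} {hp : IsStarProjection p} {ha : IsStarProjection a}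
    (h : ProjSubequiv p a) : Le (mk (MatProj.single p hp)) (mk (MatProj.single a ha)) := by
  obtain ⟨q, hq, hqa, hpq⟩ := h
  rw [mk_single_eq_of_projEquiv hpq (hq := hq), mk_eq_cls (MatProj.single a ha)]
  exact mk_single_le_cls_of_mem_closure _ (0 : Fin 1) (0 : Fin 1) hq (c := 1) (d := 1)
    (by simp [MatProj.single]) hqa

/-- If every nonzero hereditary subalgebra of a simple algebra contains a nonzero projection, then
two nonzero classes have a common nonzero lower bound. -/
theorem exists_le_and_le (hA : IsSimpleCStarAlgebra A)
    (hSP : ∀ y : A, y ≠ 0 → ∃ q : A, IsStarProjection q ∧ q ≠ 0 ∧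
      q ∈ closure (Set.range fun x : A => (star y * y) * x * (star y * y)))
    {r s : VMonoid A} (hr : r ≠ 0) (hs : s ≠ 0) :
    ∃ (e : A) (he : IsStarProjection e), e ≠ 0 ∧ Le (mk (MatProj.single e he)) r ∧
      Le (mk (MatProj.single e he)) s := by
  obtain ⟨k, X, hX, rfl⟩ := exists_eq_cls r
  obtain ⟨l, Y, hY, rfl⟩ := exists_eq_cls s
  have hne : ∀ {k : ℕ} {X : Matrix (Fin k) (Fin k) A}, X ≠ 0 → ∃ i j, X i j ≠ 0 := by
    intro k X h
    by_contra! hc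
    exact h (by ext i j; exact hc i j)
  obtain ⟨i, j, hij⟩ := hne (mt cls_eq_zero_iff.mpr hr)
  obtain ⟨i', j', hij'⟩ := hne (mt cls_eq_zero_iff.mpr hs)
  obtain ⟨g, hg⟩ := hA.exists_mul_mul_ne_zero hij hij'
  -- Primeness gives y ≠ 0. The element y*y factors through an entry of X and through an entry of Y,
  -- so a projection in its hereditary subalgebra lies below both classes.
  set y := X i j * g * Y i' j' with hy
  obtain ⟨q, hq, hq0, hqa⟩ := hSP y hg
  refine ⟨q, hq, hq0, ?_, ?_⟩
  · exact mk_single_le_cls_of_mem_closure hX i j hq (d := star y) (c := g * Y i' j')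
      (by rw [hy]; simp only [mul_assoc]) hqa
  · exact mk_single_le_cls_of_mem_closure hY i' j' hq (d := star y * (X i j * g)) (c := 1)
      (by rw [mul_one, mul_assoc (star y), ← hy]) hqa

end VMonoid

/-! ### Arbitrarily small nonzero projections -/

namespace VMonoid

variable {A : Type*} [CStarAlgebra A]

section Multiples

theorem Le.add {x y x' y' : VMonoid A} (h : Le x y) (h' : Le x' y') : Le (x + x') (y + y') := by
  obtain ⟨a, rfl⟩ := h
  obtain ⟨b, rfl⟩ := h'
  exact ⟨a + b, add_add_add_comm _ _ _ _⟩

theorem Le.nsmul_mono (x : VMonoid A) {k l : ℕ} (h : k ≤ l) : Le (k • x) (l • x) :=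
  ⟨(l - k) • x, by rw [← add_nsmul, Nat.add_sub_cancel' h]⟩

/-- The multiples `k • x` with `k ≤ n`. -/
noncomputable def multiplesUpTo (x : VMonoid A) (n : ℕ) : Finset (VMonoid A) :=
  open Classical in (Finset.range (n + 1)).image fun k => k • x

theorem nsmul_mem_multiplesUpTo (x : VMonoid A) {n k : ℕ} (h : k ≤ n) :
    k • x ∈ multiplesUpTo x n := by
  classical
  exact Finset.mem_image.mpr ⟨k, Finset.mem_range.mpr (Nat.lt_succ_of_le h), rfl⟩

theorem apply_nsmul_of_additiveOn {J : Type*} {c : VMonoid A → J → ℕ} {T : Finset (VMonoid A)}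
    (hc : ∀ x ∈ T, ∀ y ∈ T, c (x + y) = c x + c y) {x : VMonoid A} {n : ℕ} (hn : 0 < n)
    (hT : multiplesUpTo x n ⊆ T) {k : ℕ} (hk : k ≤ n) : c (k • x) = k • c x := by
  have hmem : ∀ k ≤ n, k • x ∈ T := fun k hk => hT (nsmul_mem_multiplesUpTo x hk)
  induction k with
  | zero =>
    have h0 : (0 : VMonoid A) ∈ T := by simpa using hmem 0 (Nat.zero_le _)
    have := hc 0 h0 0 h0
    rw [add_zero] at this
    rw [zero_nsmul, zero_nsmul]
    exact left_eq_add.mp this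
  | succ k ih =>
    rw [succ_nsmul, succ_nsmul, hc _ (hmem k (by omega)) x (by simpa using hmem 1 hn),
      ih (by omega)]

end Multiples

section Small

variable [PartialOrder A] [StarOrderedRing A]

/-- In a TAI algebra, a class which absorbs a larger multiple of `x` in a smaller one forces
`x = 0`. -/
theorem eq_zero_of_nsmul_add_eq [Nontrivial A] (hfull : IsFullElement (1 : A)) (hA : IsTAI A)
    {x w : VMonoid A} {k l : ℕ} (hkl : k < l) (h : l • x + w = k • x) : x = 0 := by
  classical
  choose N X hX hN using fun x : VMonoid A => exists_eq_cls x
  obtain ⟨p, hp, ⟨J, c, ψ, h1, h2, h3⟩, -⟩ := hA.exists_hasCut (fun x => ⟨X x, hX x, hN x⟩)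
    (insert w (multiplesUpTo x l)) x one_pos zero_le_one hfull
  have hc : ∀ j ≤ l, c (j • x) = j • c x := fun j hj =>
    apply_nsmul_of_additiveOn h1 (Nat.zero_lt_of_lt hkl) (Finset.subset_insert _ _) hj
  have h4 := h1 (l • x) (Finset.mem_insert_of_mem (nsmul_mem_multiplesUpTo x le_rfl)) w
    (Finset.mem_insert_self _ _)
  rw [h, hc k hkl.le, hc l le_rfl] at h4
  -- In each coordinate l c(x) + c(w) = k c(x) with k < l, which in ℕ leaves only c(x) = 0.
  refine h3 (funext fun j => ?_)
  have h5 := congrFun h4 j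
  simp only [Pi.smul_apply, Pi.add_apply, smul_eq_mul] at h5
  by_contra h6
  have h7 : 0 < c x j := Nat.pos_of_ne_zero h6
  have h8 : k * c x j < l * c x j := Nat.mul_lt_mul_of_pos_right hkl h7
  omega

variable (A) in
/-- Every nonzero hereditary subalgebra contains, up to equivalence, a nonzero projection `1 - p`
such that `n[1 - p] ≤ [p]`. -/
def HasSmallComplements : Prop :=
  ∀ n : ℕ, 0 < n → ∀ a : A, 0 ≤ a → a ≠ 0 → ∃ (p : A) (hp : IsStarProjection p),
    1 - p ≠ 0 ∧ Le (n • mk (MatProj.single (1 - p) hp.one_sub)) (mk (MatProj.single p hp)) ∧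
      ProjSubequiv (1 - p) a

theorem exists_common_lower (hsimple : IsSimpleCStarAlgebra A)
    (hsmall : HasSmallComplements A) {r s : VMonoid A} (hr : r ≠ 0) (hs : s ≠ 0) :
    ∃ (e : A) (he : IsStarProjection e), e ≠ 0 ∧ Le (mk (MatProj.single e he)) r ∧
      Le (mk (MatProj.single e he)) s := by
  refine exists_le_and_le hsimple (fun y hy => ?_) hr hs
  obtain ⟨p, hp, hp0, -, q, hq, hqa, hpq⟩ := hsmall 1 one_pos (star y * y) (star_mul_self_nonneg y)
    (by rwa [Ne, CStarRing.star_mul_self_eq_zero_iff])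
  refine ⟨q, hq, ?_, hqa⟩
  rw [Ne, ← mk_single_eq_zero_iff (hp := hq),
    ← mk_single_eq_of_projEquiv hpq (hp := hp.one_sub), mk_single_eq_zero_iff]
  exact hp0

/-- Choose K with [1] ≤ K[r], and 1 - p ≼ r with (K + 1)[1 - p] ≤ [p]. Then [r] = [1 - p] + t, and t
= 0 would place K + 1 copies of r below K copies, so r = 0. A common nonzero lower bound of [1 - p]
and t fits twice into r. -/
theorem exists_two_nsmul_le (hsimple : IsSimpleCStarAlgebra A)
    (hsmall : HasSmallComplements A) (hA : IsTAI A) {r : A} (hr : IsStarProjection r)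
    (hr0 : r ≠ 0) :
    ∃ (e : A) (he : IsStarProjection e), e ≠ 0 ∧
      Le (2 • mk (MatProj.single e he)) (mk (MatProj.single r hr)) := by
  have _ := hsimple.1
  obtain ⟨K, w₁, hK⟩ := exists_one_le_nsmul hsimple hr hr0
  obtain ⟨p, hp, hp0, ⟨w₂, hn⟩, ha⟩ := hsmall (K + 1) K.succ_pos r hr.nonneg hr0
  obtain ⟨t, ht⟩ := mk_single_le_of_projSubequiv (hp := hp.one_sub) (ha := hr) ha
  have h1 : mk (MatProj.single p hp) + mk (MatProj.single (1 - p) hp.one_sub) =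
      mk (MatProj.single (1 : A) (IsStarProjection.one A)) := by
    rw [← cls_single_eq (0 : Fin 1), ← cls_single_eq (0 : Fin 1), ← cls_single_eq (0 : Fin 1),
      ← cls_add _ _ (by simp [mul_sub, hp.isIdempotentElem.eq])]
    congr 1
    rw [← Matrix.single_add, add_sub_cancel]
  have ht0 : t ≠ 0 := by
    rintro rfl
    rw [add_zero] at ht
    rw [ht] at hn h1
    have := eq_zero_of_nsmul_add_eq (hsimple.isFullElement one_ne_zero) hA (Nat.lt_succ_self K)
      (x := mk (MatProj.single r hr)) (w := w₂ + mk (MatProj.single r hr) + w₁)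
      (by rw [← hK, ← h1, ← hn]; simp only [Nat.succ_eq_add_one]; abel)
    exact hr0 (mk_single_eq_zero_iff.mp this)
  obtain ⟨e, he, he0, h2, h3⟩ := exists_common_lower hsimple hsmall
    (mt mk_single_eq_zero_iff.mp hp0) ht0
  refine ⟨e, he, he0, ?_⟩
  rw [two_nsmul, ← ht]
  exact h2.add h3

theorem exists_nsmul_le (hsimple : IsSimpleCStarAlgebra A)
    (hsmall : HasSmallComplements A) (hA : IsTAI A) (n : ℕ) {r : A}
    (hr : IsStarProjection r) (hr0 : r ≠ 0) :
    ∃ (e : A) (he : IsStarProjection e), e ≠ 0 ∧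
      Le (n • mk (MatProj.single e he)) (mk (MatProj.single r hr)) := by
  suffices h : ∀ k : ℕ, ∃ (e : A) (he : IsStarProjection e), e ≠ 0 ∧
      Le ((2 ^ k) • mk (MatProj.single e he)) (mk (MatProj.single r hr)) by
    obtain ⟨e, he, he0, h1⟩ := h n
    exact ⟨e, he, he0, (Le.nsmul_mono _ Nat.lt_two_pow_self.le).trans h1⟩
  intro k
  induction k with
  | zero => exact ⟨r, hr, hr0, by rw [pow_zero, one_nsmul]; exact Le.refl _⟩
  | succ k ih =>
    obtain ⟨e, he, he0, h1⟩ := ih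
    obtain ⟨f, hf, hf0, h2⟩ := exists_two_nsmul_le hsimple hsmall hA he he0
    refine ⟨f, hf, hf0, Le.trans ?_ h1⟩
    rw [pow_succ, mul_nsmul']
    exact h2.nsmul _

theorem exists_forall_nsmul_le (hsimple : IsSimpleCStarAlgebra A)
    (hsmall : HasSmallComplements A) (hA : IsTAI A) (n : ℕ) (R : Finset (VMonoid A))
    (hR : ∀ r ∈ R, r ≠ 0) : ∃ (e : A) (he : IsStarProjection e), e ≠ 0 ∧
      ∀ r ∈ R, Le (n • mk (MatProj.single e he)) r := by
  classical
  have _ := hsimple.1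
  suffices h : ∃ (e : A) (he : IsStarProjection e), e ≠ 0 ∧
      ∀ r ∈ R, Le (mk (MatProj.single e he)) r by
    obtain ⟨e, he, he0, h1⟩ := h
    obtain ⟨f, hf, hf0, h2⟩ := exists_nsmul_le hsimple hsmall hA n he he0
    exact ⟨f, hf, hf0, fun r hr => h2.trans (h1 r hr)⟩
  induction R using Finset.induction_on with
  | empty => exact ⟨1, IsStarProjection.one A, one_ne_zero, by simp⟩
  | insert r R _ ih =>
    obtain ⟨e, he, he0, h1⟩ := ih fun s hs => hR s (Finset.mem_insert_of_mem hs)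
    obtain ⟨f, hf, hf0, h2, h3⟩ := exists_common_lower hsimple hsmall
      (mt mk_single_eq_zero_iff.mp he0) (hR r (Finset.mem_insert_self _ _))
      (r := mk (MatProj.single e he))
    refine ⟨f, hf, hf0, fun s hs => ?_⟩
    rcases Finset.mem_insert.mp hs with rfl | hs
    · exact h3
    · exact h2.trans (h1 s hs)

end Small

end VMonoid

/-! ### The order on K₀(A) -/

namespace VMonoid

variable {A : Type*} [CStarAlgebra A]

section KZero

variable (A) in
/-- The canonical map from `V(A)` to `K₀(A)`. -/
abbrev toKZero : VMonoid A →+ KZero A := Algebra.GrothendieckAddGroup.of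

theorem toKZero_mem (x : VMonoid A) : toKZero A x ∈ KZeroPos A := ⟨x, rfl⟩

/-- Cancellation in V(A) is never assumed. The extra s is put into the finite set to be cut and
cancelled after applying c, in `J → ℕ`. -/
theorem toKZero_eq_iff {x y : VMonoid A} : toKZero A x = toKZero A y ↔ ∃ s, s + x = s + y := by
  refine (AddLocalization.addMonoidOf (⊤ : AddSubmonoid (VMonoid A))).eq_iff_exists.trans ?_
  exact ⟨fun ⟨s, hs⟩ => ⟨s, hs⟩, fun ⟨s, hs⟩ => ⟨⟨s, trivial⟩, hs⟩⟩

theorem exists_eq_toKZero_sub (g : KZero A) : ∃ x y, g = toKZero A x - toKZero A y := by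
  obtain ⟨⟨x, y⟩, h⟩ := (AddLocalization.addMonoidOf (⊤ : AddSubmonoid (VMonoid A))).surj g
  exact ⟨x, y, eq_sub_of_add_eq h⟩

theorem Le.toKZero_sub_mem {x y : VMonoid A} (h : Le x y) :
    toKZero A y - toKZero A x ∈ KZeroPos A := by
  obtain ⟨z, rfl⟩ := h
  rw [map_add, add_sub_cancel_left]
  exact toKZero_mem z

end KZero

variable [PartialOrder A] [StarOrderedRing A]

theorem isOrderedGroup_KZeroPos [Nontrivial A] (hfull : IsFullElement (1 : A)) (hA : IsTAI A) :
    IsOrderedGroup (KZeroPos A) := by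
  classical
  refine ⟨fun g => ?_, ?_⟩
  · obtain ⟨x, y, rfl⟩ := exists_eq_toKZero_sub g
    exact ⟨_, toKZero_mem x, _, toKZero_mem y, rfl⟩
  · rintro _ ⟨x, rfl⟩ ⟨y, hy⟩
    have h0 : toKZero A (x + y) = toKZero A 0 := by
      rw [map_add, hy, map_zero, add_neg_cancel]
    obtain ⟨s, hs⟩ := toKZero_eq_iff.mp h0
    choose N X hX hN using fun x : VMonoid A => exists_eq_cls x
    obtain ⟨p, hp, ⟨J, c, ψ, h1, -, h3⟩, -⟩ := hA.exists_hasCut (fun x => ⟨X x, hX x, hN x⟩)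
      {x, y, s, x + y} x one_pos zero_le_one hfull
    have h4 := h1 s (by simp) (x + y) (by simp)
    rw [h1 x (by simp) y (by simp), hs, add_zero, left_eq_add] at h4
    rw [h3 (funext fun j => ?_), map_zero]
    have := congrFun h4 j
    simp only [Pi.add_apply, Pi.zero_apply] at this ⊢
    omega

/-- In a simple TAI algebra, finitely many relations in `V(A)` can be tested in a free monoid
`J → ℕ`, with errors smaller than a given fraction of given nonzero classes. -/
theorem exists_cut (hsimple : IsSimpleCStarAlgebra A) (hA : IsTAI A) {N : VMonoid A → ℕ}
    (hN : ∀ x, ∃ (X : Matrix (Fin (N x)) (Fin (N x)) A) (hX : IsStarProjection X), x = cls X hX)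
    (T : Finset (VMonoid A)) (K n : ℕ) (R : Finset (VMonoid A)) (hR : ∀ r ∈ R, r ≠ 0) :
    ∃ (J : Type) (c : VMonoid A → J → ℕ) (ψ : (J → ℕ) →+ VMonoid A) (u : VMonoid A) (d : J → ℕ),
      (∀ x ∈ T, ∀ y ∈ T, c (x + y) = c x + c y) ∧
      (∀ x ∈ T, ∃ y, x = ψ (c x) + y ∧ Le y (N x • u)) ∧ (∀ r ∈ R, n • d ≤ c r) ∧
      toKZero A (ψ d) - toKZero A (K • u) ∈ KZeroPos A := by
  classical
  have _ := hsimple.1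
  -- Either remainders can always be avoided, and u = d = 0 works, or one fixed problem (`T₀`, `x₀`)
  -- has no cut with u = 0. Solving that problem below each nonzero positive element then forces 1 -
  -- p ≠ 0.
  by_cases hα : ∀ T x₀, HasCut N T x₀ 0
  · obtain ⟨J, c, ψ, h1, h2, -⟩ := hα T 0
    exact ⟨J, c, ψ, 0, 0, h1, h2, fun r _ => by rw [smul_zero]; exact zero_le,
      by simp only [map_zero, smul_zero, sub_zero]; exact zero_mem _⟩
  push Not at hα
  obtain ⟨T₀, x₀, hT₀⟩ := hα
  have hsmall : HasSmallComplements A := by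
    intro n hn a ha ha0
    obtain ⟨p, hp, h1, h2, h3⟩ := hA.exists_hasCut hN T₀ x₀ hn ha (hsimple.isFullElement ha0)
    refine ⟨p, hp, fun h0 => hT₀ ?_, h2, h3⟩
    rwa [mk_single_eq_zero_iff.mpr h0] at h1
  obtain ⟨e, he, he0, h4⟩ := exists_forall_nsmul_le hsimple hsmall hA (K * n) R hR
  set E := mk (MatProj.single e he) with hE
  -- With u ≤ [f], `N E` copies of u pay for the remainder of E, and one more copy leaves u below
  -- ψ(c E) in K₀(A).
  obtain ⟨f, hf, hf0, w, hw⟩ := exists_nsmul_le hsimple hsmall hA (N E + 1) he he0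
  choose! t ht using h4
  obtain ⟨p, hp, ⟨J, c, ψ, h1, h2, -⟩, -, h3⟩ := hA.exists_hasCut hN
    (T ∪ (multiplesUpTo E (K * n + 1) ∪ R.image t)) 0 one_pos hf.nonneg (hsimple.isFullElement hf0)
  obtain ⟨v, hv⟩ := mk_single_le_of_projSubequiv (hp := hp.one_sub) (ha := hf) h3
  set u := mk (MatProj.single (1 - p) hp.one_sub)
  -- The bound `K * n + 1` rather than `K * n` keeps E itself in the list when K n = 0.
  have hM : multiplesUpTo E (K * n + 1) ⊆ T ∪ (multiplesUpTo E (K * n + 1) ∪ R.image t) :=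
    Finset.subset_union_left.trans Finset.subset_union_right
  have hc : ∀ k ≤ K * n + 1, c (k • E) = k • c E := fun k hk =>
    apply_nsmul_of_additiveOn h1 (Nat.succ_pos _) hM hk
  refine ⟨J, c, ψ, u, K • c E, fun x hx y hy => h1 x (Finset.mem_union_left _ hx) y
    (Finset.mem_union_left _ hy), fun x hx => h2 x (Finset.mem_union_left _ hx), fun r hr => ?_, ?_⟩
  · have h5 := h1 _ (hM (nsmul_mem_multiplesUpTo E (Nat.le_succ (K * n)))) (t r)
      (Finset.mem_union_right _ (Finset.mem_union_right _ (Finset.mem_image_of_mem _ hr)))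
    rw [ht r hr, hc _ (Nat.le_succ _)] at h5
    rw [h5, smul_smul, mul_comm]
    exact le_self_add
  · have hEM : E ∈ multiplesUpTo E (K * n + 1) := by
      simpa using nsmul_mem_multiplesUpTo E (Nat.le_add_left 1 (K * n))
    obtain ⟨y, hy, z, hz⟩ := h2 E (hM hEM)
    have h6 : toKZero A (ψ (c E)) - toKZero A u = toKZero A ((N E + 1) • v + w + z) := by
      have e1 := congrArg (toKZero A) hy
      have e2 := congrArg (toKZero A) hz
      have e3 := congrArg (toKZero A) hw
      rw [← hv] at e3
      simp only [map_add, map_nsmul, smul_add, add_smul, one_smul] at e1 e2 e3 ⊢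
      rw [e1, ← e2] at e3
      rw [sub_eq_iff_eq_add]
      have e4 := add_right_cancel (b := toKZero A y) (a := toKZero A (ψ (c E)))
        (c := N E • (toKZero A) v + (toKZero A) v + (toKZero A) w + (toKZero A) z + (toKZero A) u)
        (by rw [← e3]; abel)
      exact e4
    rw [map_nsmul, map_nsmul, map_nsmul, ← smul_sub, h6]
    exact nsmul_mem (toKZero_mem _) K

theorem isWeaklyUnperforated_KZeroPos (hsimple : IsSimpleCStarAlgebra A) (hA : IsTAI A) :
    IsWeaklyUnperforated (KZeroPos A) := by
  classical
  rintro g n hn ⟨r, hr⟩ hng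
  refine ⟨?_, fun h => hng (by rw [h, smul_zero])⟩
  have hr0 : r ≠ 0 := by
    rintro rfl
    exact hng (by rw [← hr, map_zero])
  obtain ⟨p, q, rfl⟩ := exists_eq_toKZero_sub g
  have h0 : toKZero A (n • p) = toKZero A (n • q + r) := by
    rw [map_add, map_nsmul, map_nsmul]
    change _ = _ + Algebra.GrothendieckAddGroup.of r
    rw [hr, smul_sub, add_sub_cancel]
  obtain ⟨s, hs⟩ := toKZero_eq_iff.mp h0
  choose N X hX hN using fun x : VMonoid A => exists_eq_cls x
  -- Only the remainder of q enters negatively in p - q, so ψ(d) has to dominate just `N q` copies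
  -- of u.
  obtain ⟨J, c, ψ, u, d, h1, h2, h3, h4⟩ := exists_cut hsimple hA
    (fun x => ⟨X x, hX x, hN x⟩)
    (multiplesUpTo p n ∪ (multiplesUpTo q n ∪ {s, r, n • q + r})) (N q) n {r} (by simpa using hr0)
  have hp : multiplesUpTo p n ⊆ multiplesUpTo p n ∪ (multiplesUpTo q n ∪ {s, r, n • q + r}) :=
    Finset.subset_union_left
  have hq : multiplesUpTo q n ⊆ multiplesUpTo p n ∪ (multiplesUpTo q n ∪ {s, r, n • q + r}) :=
    Finset.subset_union_left.trans Finset.subset_union_right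
  have h5 := h1 s (by simp) _ (hp (nsmul_mem_multiplesUpTo p le_rfl))
  rw [hs, h1 s (by simp) _ (by simp), h1 _ (hq (nsmul_mem_multiplesUpTo q le_rfl)) r (by simp),
    apply_nsmul_of_additiveOn h1 hn hp le_rfl, apply_nsmul_of_additiveOn h1 hn hq le_rfl] at h5
  -- From n c(p) = n c(q) + c(r) and n d ≤ c(r), division by n is legitimate in ℕ.
  have h6 : c q + d ≤ c p := fun j => by
    have h7 := congrFun h5 j
    have h8 := h3 r (by simp) j
    simp only [Pi.add_apply, Pi.smul_apply, smul_eq_mul] at h7 h8 ⊢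
    refine Nat.le_of_mul_le_mul_left ?_ hn
    rw [mul_add]
    omega
  obtain ⟨m, hm⟩ := exists_add_of_le h6
  obtain ⟨y, hy, -⟩ := h2 p (hp (by simpa using nsmul_mem_multiplesUpTo p hn))
  obtain ⟨y', hy', hle⟩ := h2 q (hq (by simpa using nsmul_mem_multiplesUpTo q hn))
  have h7 := add_mem (add_mem (toKZero_mem (y + ψ m)) h4) hle.toKZero_sub_mem
  convert h7 using 1
  have e1 := congrArg (toKZero A) hy
  have e2 := congrArg (toKZero A) hy'
  rw [hm] at e1
  simp only [map_add] at e1 e2 ⊢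
  rw [e1, e2]
  abel

theorem hasRieszInterpolation_KZeroPos (hsimple : IsSimpleCStarAlgebra A) (hA : IsTAI A) :
    HasRieszInterpolation (KZeroPos A) := by
  classical
  suffices h : ∀ a b : Fin 2 → KZero A, (∀ i j, b j - a i ∈ KZeroPos A) →
      ∃ c, (∀ i, c - a i ∈ KZeroPos A) ∧ ∀ j, b j - c ∈ KZeroPos A by
    intro a₁ a₂ b₁ b₂ h11 h12 h21 h22
    obtain ⟨c, h1, h2⟩ := h ![a₁, a₂] ![b₁, b₂] (by
      simp only [Fin.forall_fin_two]
      exact ⟨⟨h11, h12⟩, h21, h22⟩)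
    exact ⟨c, h1 0, h1 1, h2 0, h2 1⟩
  intro a b hab
  -- If some a i equals some b j, it interpolates. Otherwise all differences come from nonzero
  -- classes, as the absorption of errors requires.
  by_cases h0 : ∃ i j, b j - a i = 0
  · obtain ⟨i, j, hij⟩ := h0
    rw [sub_eq_zero] at hij
    exact ⟨a i, fun k => hij ▸ hab k j, fun k => hab i k⟩
  push Not at h0
  choose r hr using hab
  have hr0 : ∀ i j, r i j ≠ 0 := fun i j h => h0 i j (by rw [← hr, h, map_zero])
  choose x x' hx using fun i => exists_eq_toKZero_sub (a i)
  choose z z' hz using fun j => exists_eq_toKZero_sub (b j)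
  obtain ⟨s, p, q, hp, hq⟩ : ∃ (s : VMonoid A) (p q : Fin 2 → VMonoid A),
      (∀ i, a i = toKZero A (p i) - toKZero A s) ∧ ∀ j, b j = toKZero A (q j) - toKZero A s := by
    refine ⟨x' 0 + x' 1 + (z' 0 + z' 1), ![x 0 + x' 1 + (z' 0 + z' 1), x 1 + x' 0 + (z' 0 + z' 1)],
      ![z 0 + z' 1 + (x' 0 + x' 1), z 1 + z' 0 + (x' 0 + x' 1)], ?_, ?_⟩
    · rw [Fin.forall_fin_two]
      constructor
      · rw [hx]; simp
      · rw [hx]; simp; abel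
    · rw [Fin.forall_fin_two]
      constructor
      · rw [hz]; simp; abel
      · rw [hz]; simp; abel
  have h1 : ∀ i j, ∃ t, t + q j = t + (p i + r i j) := fun i j => by
    rw [← toKZero_eq_iff, map_add]
    change _ = _ + Algebra.GrothendieckAddGroup.of (r i j)
    rw [hr, hp, hq]
    abel
  choose t ht using h1
  choose N X hX hN using fun x : VMonoid A => exists_eq_cls x
  let U : (Fin 2 → Fin 2 → VMonoid A) → Finset (VMonoid A) := fun f =>
    Finset.univ.image fun k : Fin 2 × Fin 2 => f k.1 k.2
  have hU : ∀ f i j, f i j ∈ U f := fun f i j => Finset.mem_image_of_mem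
    (fun k : Fin 2 × Fin 2 => f k.1 k.2) (Finset.mem_univ (i, j))
  obtain ⟨J, c, ψ, u, d, h1, h2, h3, h4⟩ := exists_cut hsimple hA (fun x => ⟨X x, hX x, hN x⟩)
    (U t ∪ U r ∪ U (fun i j => p i + r i j) ∪ (U (fun i _ => p i) ∪ U fun _ j => q j))
    (N (p 0) + N (p 1)) 1 (U r) (fun y hy => by
      obtain ⟨k, -, rfl⟩ := Finset.mem_image.mp hy
      exact hr0 _ _)
  set T := U t ∪ U r ∪ U (fun i j => p i + r i j) ∪ (U (fun i _ => p i) ∪ U fun _ j => q j)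
  have hTt : ∀ i j, t i j ∈ T := fun i j => by simp [T, hU]
  have hTr : ∀ i j, r i j ∈ T := fun i j => by simp [T, hU]
  have hTpr : ∀ i j, p i + r i j ∈ T := fun i j => by
    simp [T, hU (fun i j => p i + r i j) i j]
  have hTp : ∀ i, p i ∈ T := fun i => by simp [T, hU (fun i _ => p i) i 0]
  have hTq : ∀ j, q j ∈ T := fun j => by simp [T, hU (fun _ j => q j) 0 j]
  have h5 : ∀ i j, c (p i) + d ≤ c (q j) := fun i j => by
    have h6 := h1 _ (hTt i j) _ (hTq j)
    rw [ht, h1 _ (hTt i j) _ (hTpr i j), h1 _ (hTp i) _ (hTr i j)] at h6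
    rw [← add_left_cancel h6]
    simpa using h3 _ (hU r i j)
  have h6 : ∀ j, (c (p 0) ⊔ c (p 1)) + d ≤ c (q j) := fun j k => by
    have h7 := h5 0 j k
    have h8 := h5 1 j k
    simp only [Pi.add_apply, Pi.sup_apply] at h7 h8 ⊢
    omega
  choose y hy hle using fun i => h2 _ (hTp i)
  -- The factor N(p 0) + N(p 1) was chosen so that ψ(d) absorbs both remainders at once.
  have hpos : toKZero A (ψ d) - (toKZero A (y 0) + toKZero A (y 1)) ∈ KZeroPos A := by
    convert add_mem (add_mem h4 (hle 0).toKZero_sub_mem) (hle 1).toKZero_sub_mem using 1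
    rw [add_smul, map_add]
    abel
  set m := c (p 0) ⊔ c (p 1)
  -- Adding both remainders puts the element above each p i = ψ(c(p i)) + y i; the gap d between m
  -- and c(q j) pays for them below q j.
  refine ⟨toKZero A (ψ m + y 0 + y 1) - toKZero A s, ?_, fun j => ?_⟩
  · have h7 : ∀ i k, c (p i) ≤ m → ψ m + y 0 + y 1 = ψ m + y i + y k →
        toKZero A (ψ m + y 0 + y 1) - toKZero A s - a i ∈ KZeroPos A := fun i k hi hk => by
      obtain ⟨l, hl⟩ := exists_add_of_le hi
      rw [hk, hl, hp]
      convert toKZero_mem (ψ l + y k) using 1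
      have e1 := congrArg (toKZero A) (hy i)
      simp only [map_add] at e1 ⊢
      rw [e1]
      abel
    rw [Fin.forall_fin_two]
    exact ⟨h7 0 1 le_sup_left rfl,
      h7 1 0 le_sup_right (add_right_comm _ _ _)⟩
  · obtain ⟨l, hl⟩ := exists_add_of_le (h6 j)
    obtain ⟨y', hy', -⟩ := h2 _ (hTq j)
    convert add_mem (toKZero_mem (ψ l + y')) hpos using 1
    have e1 := congrArg (toKZero A) hy'
    rw [hl] at e1
    rw [hq]
    simp only [map_add] at e1 ⊢
    rw [e1]
    abel

end VMonoid

theorem theorem4p8 {A : Type*} [CStarAlgebra A] [PartialOrder A] [StarOrderedRing A]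
    (hsimple : IsSimpleCStarAlgebra A) (hTAI : IsTAI A) :
    IsOrderedGroup (KZeroPos A) ∧ IsWeaklyUnperforated (KZeroPos A) ∧
      HasRieszInterpolation (KZeroPos A) := by
  have _ := hsimple.1
  exact ⟨VMonoid.isOrderedGroup_KZeroPos (hsimple.isFullElement one_ne_zero) hTAI,
    VMonoid.isWeaklyUnperforated_KZeroPos hsimple hTAI,
    VMonoid.hasRieszInterpolation_KZeroPos hsimple hTAI⟩
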